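/- Conventions. Graphs are undirected; parallel edges and self-loops are allowed. A loop counts as one edge incident to its vertex, as one step of a walk, and as $1$ on the diagonal of the adjacency matrix. For a connected graph $X$ of uniformly bounded degree, the spectral radius is $\rho(X)=\limsup_{t\to\infty}(c^{(t)}_{uv})^{1/t}$, where $c^{(t)}_{uv}$ is the number of walks of length $t$ from vertex $u$ to vertex $v$; it does not depend on $u,v$. A graph $X$ covers a graph $G$ if there are surjections $f_V:V(X)\to V(G)$ and $f_E:E(X)\to E(G)$ such that an edge with ends $u,v$ is sent to an edge with ends $f_V(u),f_V(v)$, and such that for every vertex $u$ of $X$ the map $f_E$ is a bijection from the edges incident to $u$ onto the edges incident to $f_V(u)$. Let $\mathrm{FinQuo}(X)$ be the family of finite graphs covered by $X$, up to isomorphism. All members of $\mathrm{FinQuo}(X)$ have the same spectral radius; if $\mathrm{FinQuo}(X)\neq\emptyset$, this common value is denoted $\chi(X)$. For a finite graph $G$ let $\lambda_1(G)\ge\lambda_2(G)\ge\cdots\ge\lambda_{|V(G)|}(G)$ be the eigenvalues of its adjacency matrix, with multiplicity. For an integer $k\ge1$, $X$ is $k$-quasi-Ramanujan if there are infinitely many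 pairwise non-isomorphic $G\in\mathrm{FinQuo}(X)$ with $|V(G)|\ge k+1$ and $\lambda_{k+1}(G)\le\rho(X)$. Additive products. Let $A_1,\dots,A_c$ be finite simple undirected graphs on the common vertex set $[n]$ such that the sum graph $A_1+\cdots+A_c$ (the union of the edge sets, with multiplicity) is connected, and such that each $\underline{A}_j$, which is $A_j$ with its isolated vertices removed, is nonempty and connected. Fix $v_1\in[n]$. The additive product graph $A_1\oplus\cdots\oplus A_c$ has as vertices all strings $v_1C_1v_2C_2\cdots v_kC_kv_{k+1}$, $k\ge0$, with $v_i\in[n]$ and $C_i\in[c]$, such that $C_i\ne C_{i+1}$ for all $i<k$, and such that $v_i$ and $v_{i+1}$ are distinct vertices of $\underline{A}_{C_i}$ for all $i\le k$. Two of these strings are joined by an edge exactly if they have the form $\{sCu,\,sCv\}$ with $\{u,v\}$ an edge of $A_C$, or the form $\{s,\,sCv\}$ where the last vertex $u$ of $s$ satisfies that $\{u,v\}$ is an edge of $A_C$. Theorem. Let $X=A_1\oplus\cdots\oplus A_c$ be an additive product graph, with atoms on the common vertex set $[n]$, such that $\chi(X)>\rho(X)$. Then $X$ is $k$-quasi-Ramanujan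 for some integer $k\ge1$, and in fact $k=n$ works: there are infinitely many pairwise non-isomorphic finite graphs $G$ covered by $X$ with $|V(G)|\ge n+1$ and $\lambda_{n+1}(G)\le\rho(X)$. -/

import Mathlib

open Filter
open scoped Graph

/-! ### Multigraphs: walks, spectral radius, coverings, eigenvalues

Graphs are Mathlib's multigraphs `Graph α β` (parallel edges and loops allowed). A loop counts once
as an edge incident to its vertex, as one step of a walk, and as `1` on the diagonal of the
adjacency matrix. -/

namespace XRam

universe u v u' v'

/-- Walks of length `t` from `x` to `y` in a multigraph, recorded with the edges they use. -/
inductive Walk {α : Type u} {β : Type v} (G : Graph α β) : ℕ → α → α → Type (max u v)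
  | nil {x : α} (hx : x ∈ V(G)) : Walk G 0 x x
  | cons {t : ℕ} {x y z : α} (e : β) (h : G.IsLink e x y) (p : Walk G t y z) : Walk G (t + 1) x z

/-- The number of walks of length `t` from `x` to `y` (finite if all degrees are finite). -/
noncomputable def walkCount {α : Type u} {β : Type v} (G : Graph α β) (t : ℕ) (x y : α) : ℕ :=
  Nat.card (Walk G t x y)

/-- The spectral radius `limsup_t (number of walks of length t from x to y)^(1/t)`. For a connected
graph with bounded degrees the limsup does not depend on `x` and `y`, so the supremum over all pairs
of vertices is its common value. -/
noncomputable def specRadius {α : Type u} {β : Type v} (G : Graph α β) : ℝ :=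
  ⨆ p : V(G) × V(G),
    limsup (fun t : ℕ => (walkCount G t p.1 p.2 : ℝ) ^ (1 / (t : ℝ))) atTop

/-- `(fV, fE)` is a covering map from `G` onto `H`. -/
structure IsCovering {α : Type u} {β : Type v} {α' : Type u'} {β' : Type v'}
    (G : Graph α β) (H : Graph α' β') (fV : V(G) → V(H)) (fE : E(G) → E(H)) : Prop where
  surjective_vertex : Function.Surjective fV
  surjective_edge : Function.Surjective fE
  map_isLink : ∀ (e : E(G)) (x y : V(G)), G.IsLink e x y → H.IsLink (fE e) (fV x) (fV y)
  bijOn_incident : ∀ x : V(G),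
    Set.BijOn fE {e : E(G) | G.Inc e x} {e : E(H) | H.Inc e (fV x)}

/-- `G` is a cover of `H`, i.e. `H` is a quotient of `G`. -/
def Covers {α : Type u} {β : Type v} {α' : Type u'} {β' : Type v'}
    (G : Graph α β) (H : Graph α' β') : Prop :=
  ∃ (fV : V(G) → V(H)) (fE : E(G) → E(H)), IsCovering G H fV fE

/-- Isomorphism of multigraphs. -/
def Isomorphic {α : Type u} {β : Type v} {α' : Type u'} {β' : Type v'}
    (G : Graph α β) (H : Graph α' β') : Prop :=
  ∃ (fV : V(G) ≃ V(H)) (fE : E(G) ≃ E(H)),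
    ∀ (e : E(G)) (x y : V(G)), G.IsLink e x y ↔ H.IsLink (fE e) (fV x) (fV y)

/-- A finite multigraph. -/
structure FinGraph where
  /-- ambient type of the vertices -/
  α : Type
  /-- ambient type of the edges -/
  β : Type
  /-- the multigraph -/
  graph : Graph α β
  finite_vertexSet : Finite V(graph)
  finite_edgeSet : Finite E(graph)

/-- The finite graphs covered by `X`. (They are connected if `X` is.) -/
def FinQuo {α : Type u} {β : Type v} (X : Graph α β) : Set FinGraph :=
  {G | Covers X G.graph}

/-- The common spectral radius of all finite graphs covered by `X`: for connected `X` of bounded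
degree with `FinQuo X` nonempty, the set below has exactly one element. -/
noncomputable def chi {α : Type u} {β : Type v} (X : Graph α β) : ℝ :=
  sSup {r : ℝ | ∃ G ∈ FinQuo X, r = specRadius G.graph}

noncomputable instance (G : FinGraph) : Fintype V(G.graph) :=
  @Fintype.ofFinite _ G.finite_vertexSet

noncomputable instance (G : FinGraph) : DecidableEq V(G.graph) :=
  Classical.decEq _

/-- The adjacency matrix: the `(x, y)` entry is the number of edges with ends `x` and `y`. -/
noncomputable def FinGraph.adjMatrix (G : FinGraph) : Matrix V(G.graph) V(G.graph) ℝ :=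
  Matrix.of fun x y => (Nat.card {e : E(G.graph) // G.graph.IsLink e x y} : ℝ)

theorem FinGraph.isHermitian_adjMatrix (G : FinGraph) : G.adjMatrix.IsHermitian := by
  ext x y
  simp only [FinGraph.adjMatrix, Matrix.conjTranspose_apply, Matrix.of_apply, star_trivial,
    Graph.isLink_comm]

/-- The eigenvalues of the adjacency matrix with multiplicity, in decreasing order and indexed
from `0`: `G.eigenvalue ⟨i, _⟩` is the `(i + 1)`-st largest eigenvalue. -/
noncomputable def FinGraph.eigenvalue (G : FinGraph) :
    Fin (Fintype.card V(G.graph)) → ℝ :=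
  G.isHermitian_adjMatrix.eigenvalues₀

/-- `X` is `k`-quasi-Ramanujan: there are infinitely many pairwise non-isomorphic finite graphs
covered by `X` that have a `(k + 1)`-st largest eigenvalue, and this eigenvalue is at most the
spectral radius of `X`. -/
def IsQuasiRamanujan {α : Type u} {β : Type v} (k : ℕ) (X : Graph α β) : Prop :=
  1 ≤ k ∧ ∃ G : ℕ → FinGraph,
    (∀ i, G i ∈ FinQuo X ∧
      ∃ hk : k < Fintype.card V((G i).graph), (G i).eigenvalue ⟨k, hk⟩ ≤ specRadius X) ∧
    ∀ i j, i ≠ j → ¬ Isomorphic (G i).graph (G j).graph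

/-! ### The additive product

The string `v₁ C₁ v₂ C₂ ⋯ v_k C_k v_{k+1}` is encoded, for fixed `v₁`, by the list
`[(C_k, v_{k+1}), …, (C₁, v₂)]`, so that extending the string is consing to the list. -/

section AdditiveProduct

variable {n c : ℕ}

/-- The last vertex of a string starting at `v₁`. -/
def endpoint (v₁ : Fin n) : List (Fin c × Fin n) → Fin n
  | [] => v₁
  | (_, v) :: _ => v

/-- The strings that are vertices of the additive product: consecutive colours differ, and
consecutive vertices `v_i`, `v_{i+1}` are distinct non-isolated vertices of `A C_i`. -/
def IsString (A : Fin c → SimpleGraph (Fin n)) (v₁ : Fin n) : List (Fin c × Fin n) → Prop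
  | [] => True
  | (C, v) :: s =>
    IsString A v₁ s ∧ (∀ p ∈ s.head?, p.1 ≠ C) ∧
      endpoint v₁ s ∈ (A C).support ∧ v ∈ (A C).support ∧ endpoint v₁ s ≠ v

/-- The edges of the additive product (in one of the two directions): from `s C x` to `s C y` if
`{x, y}` is an edge of `A C`, and from `s` to `s C y` if the last vertex of `s` and `y` form an
edge of `A C`. -/
inductive EdgeRule (A : Fin c → SimpleGraph (Fin n)) (v₁ : Fin n) :
    List (Fin c × Fin n) → List (Fin c × Fin n) → Prop
  | sibling (s : List (Fin c × Fin n)) (C : Fin c) (x y : Fin n) (h : (A C).Adj x y) :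
      EdgeRule A v₁ ((C, x) :: s) ((C, y) :: s)
  | child (s : List (Fin c × Fin n)) (C : Fin c) (y : Fin n) (h : (A C).Adj (endpoint v₁ s) y) :
      EdgeRule A v₁ s ((C, y) :: s)

theorem EdgeRule.ne {A : Fin c → SimpleGraph (Fin n)} {v₁ : Fin n}
    {s t : List (Fin c × Fin n)} (h : EdgeRule A v₁ s t) : s ≠ t := by
  cases h with
  | sibling s C x y h => simpa using h.ne
  | child s C y h => exact fun h' => by simpa using congrArg List.length h'

/-- The additive product of the atoms `A 0, …, A (c - 1)`, rooted at `v₁`. Its edges form a set of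
pairs of distinct strings, so it is a simple graph. -/
def additiveProduct (A : Fin c → SimpleGraph (Fin n)) (v₁ : Fin n) :
    SimpleGraph {s : List (Fin c × Fin n) // IsString A v₁ s} where
  Adj s t := EdgeRule A v₁ s.1 t.1 ∨ EdgeRule A v₁ t.1 s.1
  symm := ⟨fun _ _ h => h.symm⟩
  loopless := ⟨fun _ h => h.elim (fun h' => h'.ne rfl) (fun h' => h'.ne rfl)⟩

end AdditiveProduct

end XRam

/-! ### Perturbations of real-rooted polynomials -/

namespace XRam

open Polynomial Topology

/-! The finite quotients are lifts of the sum graph. Permutations `σ j v` of a finite set `L` glue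
copies of the atoms along `[n] × L`, and following atoms along strings maps X to the lift. When this
map is onto, it is a covering. Giving each pair (colour j, vertex a) a sign defines a double cover.
On functions that are even in the new bit, its quadratic form is that of the old lift; on odd ones
it is that of the signed matrix `∑ j, D_j A_j D_j`. So if every lift admits a signing with largest
eigenvalue at most ρ(X), iterated doubling from the sum graph bounds the form by ρ(X) on all
functions with zero fibre sums. These functions form a space of codimension n, whence the bound on
λ_{n+1}.

A good signing is found by interlacing (`exists_signFlip_charpoly_pos`). Flipping one sign replaces
Y + u uᵀ by Y + w wᵀ for a common matrix Y, and quotients of rank-one differences by the base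
polynomial map the upper half-plane to itself. Hence if the sum of two such polynomials is positive
on (ρ, ∞), one of them is. It then suffices that the sum of all signed characteristic polynomials is
positive on (ρ(X), ∞).

This positivity is `LiftsTo.signedMinorSum_pos`. In the path expansion of principal minors,
averaging over signs kills every path that changes colour. The averaged minors thus obey a recursion
along monochromatic paths, and these paths lift to X. Comparison with the minors of a large ball of
X, which are positive for x > ρ(X) because the ball has quadratic form at most ρ(X), gives
positivity by induction on the vertex set.

The hypothesis χ(X) > ρ(X) keeps the lifts connected (`exists_string_of_newQuadFormLE`). It forces
the sum graph to have an eigenvalue μ > ρ(X), and a disconnected lift would carry μ again on a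
function with zero fibre sums. -/

theorem tendsto_aeval_mul_I_div_pow (p : ℝ[X]) (n : ℕ) (hp : p.natDegree ≤ n) :
    Tendsto (fun y : ℝ => aeval ((y : ℂ) * Complex.I) p / (y : ℂ) ^ n) atTop
      (𝓝 ((p.coeff n : ℂ) * Complex.I ^ n)) := by
  have h1 : ∀ y : ℝ, aeval ((y : ℂ) * Complex.I) p / (y : ℂ) ^ n =
      ∑ k ∈ Finset.range (n + 1),
        (p.coeff k : ℂ) * Complex.I ^ k * ((y ^ k / y ^ n : ℝ) : ℂ) := by
    intro y
    rw [aeval_eq_sum_range' (Nat.lt_succ_of_le hp), Finset.sum_div]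
    refine Finset.sum_congr rfl fun k _ => ?_
    rw [Complex.real_smul]
    push_cast
    ring
  simp only [h1]
  rw [show (p.coeff n : ℂ) * Complex.I ^ n = ∑ k ∈ Finset.range (n + 1),
    (p.coeff k : ℂ) * Complex.I ^ k * ((if k = n then 1 else 0 : ℝ) : ℂ) by
      rw [Finset.sum_eq_single n]
      · simp
      · intro k _ hk; simp [hk]
      · simp]
  refine tendsto_finsetSum _ fun k hk => ?_
  refine Tendsto.const_mul _ ?_
  refine (Complex.continuous_ofReal.tendsto _).comp ?_
  split_ifs with hkn
  · subst hkn
    refine tendsto_const_nhds.congr' ?_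
    filter_upwards [eventually_gt_atTop 0] with y hy
    rw [div_self (pow_pos hy _).ne']
  · have hlt : k < n := lt_of_le_of_ne (Nat.lt_succ_iff.1 (Finset.mem_range.1 hk)) hkn
    exact tendsto_pow_div_pow_atTop_zero hlt

/-- If all real combinations `f + s g` are zero free in the upper half-plane and `g` has degree one
less than `f`, with leading coefficient of the opposite sign, then `g / f` maps the upper
half-plane to itself. -/
theorem im_div_pos_of_ne_zero {N : ℕ} {f g : ℝ[X]} (hfd : f.natDegree ≤ N + 1)
    (hf : 0 < f.coeff (N + 1)) (hgd : g.natDegree ≤ N) (hg : g.coeff N < 0)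
    (h : ∀ (s : ℝ) (z : ℂ), 0 < z.im → aeval z (f + C s * g) ≠ 0) (z : ℂ) (hz : 0 < z.im) :
    0 < (aeval z g / aeval z f).im := by
  set U : Set ℂ := {z | 0 < z.im} with hU
  have hfne : ∀ z ∈ U, aeval z f ≠ 0 := fun z hz => by simpa using h 0 z hz
  set F : ℂ → ℂ := fun z => aeval z g / aeval z f with hF
  have hUo : IsOpen U := isOpen_lt continuous_const Complex.continuous_im
  have hUc : IsPreconnected U := (convex_halfSpace_im_gt 0).isPreconnected
  have hda : ∀ p : ℝ[X], Differentiable ℂ fun z : ℂ => aeval z p := fun p => by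
    have : (fun z : ℂ => aeval z p) = fun z => (p.map (algebraMap ℝ ℂ)).eval z := by
      ext z; simp [aeval_def, eval_map]
    rw [this]
    exact Polynomial.differentiable _
  have hdiff : DifferentiableOn ℂ F U := fun z hz =>
    ((hda g).differentiableAt.div (hda f).differentiableAt (hfne z hz)).differentiableWithinAt
  have hana : AnalyticOnNhd ℂ F U := hdiff.analyticOnNhd hUo
  -- A nonzero real value r of F at z would make f - r⁻¹ g vanish at z.
  have hreal : ∀ z ∈ U, ∀ r : ℝ, F z = r → r = 0 := by
    intro z hz r hr
    by_contra hr0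
    apply h (-r⁻¹) z hz
    have : aeval z g = r * aeval z f := by
      rw [← hr, hF]; field_simp [hfne z hz]
    simp only [map_add, map_mul, aeval_C, this, Complex.coe_algebraMap]
    push_cast
    have : (r : ℂ) ≠ 0 := by exact_mod_cast hr0
    field_simp
    ring
  -- The behaviour at i∞ decides the sign of Im F: the two leading coefficients give the limit, and
  -- their opposite signs make its imaginary part positive.
  have hlim : Tendsto (fun y : ℝ => (y : ℂ) * F (y * Complex.I)) atTop
      (𝓝 (((g.coeff N / f.coeff (N + 1) : ℝ) : ℂ) / Complex.I)) := by
    have := (tendsto_aeval_mul_I_div_pow g N hgd).div (tendsto_aeval_mul_I_div_pow f (N + 1) hfd)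
      (by simp [hf.ne'])
    convert this.congr' ?_ using 2
    · push_cast
      have : (f.coeff (N + 1) : ℂ) ≠ 0 := by exact_mod_cast hf.ne'
      field_simp
      ring
    · filter_upwards [eventually_gt_atTop 0] with y hy
      have : (y : ℂ) ≠ 0 := by exact_mod_cast hy.ne'
      simp only [hF, Pi.div_apply]
      rw [pow_succ]
      have h3 := hfne (y * Complex.I) (by simpa [hU] using hy)
      field_simp
  have hlim' : Tendsto (fun y : ℝ => y * (F (y * Complex.I)).im) atTop
      (𝓝 (-(g.coeff N / f.coeff (N + 1)))) := by
    convert (Complex.continuous_im.tendsto _).comp hlim using 2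
    · simp
    · rw [Complex.div_I, Complex.neg_im, Complex.im_ofReal_mul, Complex.I_im, mul_one]
  have hpos : 0 < -(g.coeff N / f.coeff (N + 1)) := by
    rw [neg_pos]; exact div_neg_of_neg_of_pos hg hf
  obtain ⟨y, hy, hy0⟩ := ((hlim'.eventually (lt_mem_nhds hpos)).and (eventually_gt_atTop 0)).exists
  have hyI : 0 < (F (y * Complex.I)).im := pos_of_mul_pos_right hy hy0.le
  have hyU : (y * Complex.I : ℂ) ∈ U := by simpa [hU] using hy0
  -- By the open mapping theorem, a zero of a nonconstant F would put small positive reals in its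
  -- image, against `hreal`. A constant F takes its value at a point where Im F > 0 is known.
  have hne : ∀ z ∈ U, (F z).im ≠ 0 := by
    rcases hana.is_constant_or_isOpen hUc with ⟨w, hw⟩ | hopen
    · intro z hz
      rw [hw z hz, ← hw _ hyU]
      exact hyI.ne'
    · intro z hz him
      have hz0 : F z = 0 := by
        have h1 : F z = ((F z).re : ℂ) := Complex.ext rfl (by simp [him])
        rw [h1, hreal z hz _ h1]; simp
      have hn : F '' U ∈ 𝓝 (0 : ℂ) := (hopen U subset_rfl hUo).mem_nhds ⟨z, hz, hz0⟩
      have ht : Tendsto (fun r : ℝ => (r : ℂ)) (𝓝[>] 0) (𝓝 0) :=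
        ((Complex.continuous_ofReal.tendsto' 0 0 (by simp)).mono_left nhdsWithin_le_nhds)
      obtain ⟨r, ⟨w, hwU, hw⟩, hr⟩ := ((ht.eventually hn).and self_mem_nhdsWithin).exists
      exact (ne_of_gt hr) (hreal w hwU r hw)
  by_contra hcon
  push Not at hcon
  have hconn : IsPreconnected ((fun z => (F z).im) '' U) :=
    hUc.image _ (Complex.continuous_im.comp_continuousOn hdiff.continuousOn)
  have := hconn.ordConnected.out ⟨z, hz, rfl⟩ ⟨_, hyU, rfl⟩ (⟨hcon, hyI.le⟩ : (0:ℝ) ∈ Set.Icc _ _)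
  obtain ⟨w, hwU, hw⟩ := this
  exact hne w hwU hw

/-- Since F = g / f is real on the real axis, F'(x) is the limit of Im F(x + it) / t as t decreases
to 0, hence nonnegative. -/
theorem monotoneOn_div_of_im_nonneg {f g : ℝ[X]} {τ : ℝ} (hf : ∀ x > τ, f.eval x ≠ 0)
    (h : ∀ z : ℂ, 0 < z.im → 0 ≤ (aeval z g / aeval z f).im) :
    MonotoneOn (fun x => g.eval x / f.eval x) (Set.Ioi τ) := by
  have hd : ∀ x > τ, HasDerivAt (fun x => g.eval x / f.eval x)
      ((g.derivative.eval x * f.eval x - g.eval x * f.derivative.eval x) / f.eval x ^ 2) x :=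
    fun x hx => (g.hasDerivAt x).div (f.hasDerivAt x) (hf x hx)
  refine monotoneOn_of_deriv_nonneg (convex_Ioi τ)
    (fun x hx => (hd x hx).continuousAt.continuousWithinAt)
    (fun x hx => by
      rw [interior_Ioi] at hx
      exact (hd x hx).differentiableAt.differentiableWithinAt) fun x hx => ?_
  rw [interior_Ioi] at hx
  rw [(hd x hx).deriv]
  set D := (g.derivative.eval x * f.eval x - g.eval x * f.derivative.eval x) / f.eval x ^ 2 with hD
  have hae : ∀ (p : ℝ[X]) (z : ℂ), aeval z p = (p.map (algebraMap ℝ ℂ)).eval z := fun p z => by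
    simp [aeval_def, eval_map]
  have hev : ∀ p : ℝ[X], (p.map (algebraMap ℝ ℂ)).eval (x : ℂ) = ((p.eval x : ℝ) : ℂ) := fun p => by
    rw [← hae]; exact aeval_ofReal p x
  have hfx : (f.map (algebraMap ℝ ℂ)).eval (x : ℂ) ≠ 0 := by
    rw [hev]; exact_mod_cast hf x hx
  have hc : HasDerivAt (fun z : ℂ => aeval z g / aeval z f) (D : ℂ) (x : ℂ) := by
    rw [show (fun z : ℂ => aeval z g / aeval z f) = fun z => (g.map (algebraMap ℝ ℂ)).eval z /
      (f.map (algebraMap ℝ ℂ)).eval z from funext fun z => by rw [hae, hae]]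
    refine (((g.map (algebraMap ℝ ℂ)).hasDerivAt (x : ℂ)).div
      ((f.map (algebraMap ℝ ℂ)).hasDerivAt (x : ℂ)) hfx).congr_deriv ?_
    simp only [derivative_map, hev, hD]
    push_cast
    ring
  have hline : HasDerivAt (fun t : ℝ => (x : ℂ) + t * Complex.I) Complex.I 0 := by
    simpa using ((Complex.ofRealCLM.hasDerivAt (x := (0 : ℝ))).mul_const Complex.I).const_add (x : ℂ)
  have hc' : HasDerivAt (fun z : ℂ => aeval z g / aeval z f) (D : ℂ)
      ((x : ℂ) + ((0 : ℝ) : ℂ) * Complex.I) := by simpa using hc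
  have hcomp := hc'.comp_of_eq (0 : ℝ) hline rfl
  have him : HasDerivAt (fun t : ℝ => (aeval ((x : ℂ) + t * Complex.I) g /
      aeval ((x : ℂ) + t * Complex.I) f).im) D 0 := by
    have := Complex.imCLM.hasFDerivAt.comp_hasDerivAt (0 : ℝ) hcomp
    simpa [Function.comp_def] using this
  have hslope := (hasDerivAt_iff_tendsto_slope.1 him).mono_left
    (nhdsWithin_mono 0 (show Set.Ioi (0 : ℝ) ⊆ {0}ᶜ from fun t ht => (ne_of_gt ht)))
  refine ge_of_tendsto hslope ?_
  filter_upwards [self_mem_nhdsWithin] with t ht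
  rw [slope_def_field]
  have h0 : (aeval ((x : ℂ) + ((0 : ℝ) : ℂ) * Complex.I) g /
      aeval ((x : ℂ) + ((0 : ℝ) : ℂ) * Complex.I) f).im = 0 := by
    have : (x : ℂ) + ((0 : ℝ) : ℂ) * Complex.I = x := by simp
    rw [this, hae, hae, hev, hev, ← Complex.ofReal_div, Complex.ofReal_im]
  rw [h0, sub_zero, sub_zero]
  exact div_nonneg (h _ (by simpa using ht)) (le_of_lt ht)

theorem eval_pos_of_ne_zero {f : ℝ[X]} {τ : ℝ} (hl : 0 < f.leadingCoeff)
    (hf : ∀ x > τ, f.eval x ≠ 0) : ∀ x > τ, 0 < f.eval x := by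
  intro x hx
  by_contra hcon
  push Not at hcon
  have hev : ∃ y > x, 0 < f.eval y := by
    by_cases hdeg : 0 < f.degree
    · exact (((f.tendsto_atTop_of_leadingCoeff_nonneg hdeg hl.le).eventually
        (eventually_gt_atTop 0)).and (eventually_gt_atTop x)).exists.imp fun y hy => ⟨hy.2, hy.1⟩
    · rw [eq_C_of_degree_le_zero (not_lt.1 hdeg)] at hl ⊢
      exact ⟨x + 1, by linarith, by simpa using hl⟩
  obtain ⟨y, hy, hfy⟩ := hev
  obtain ⟨w, hw, hw0⟩ := intermediate_value_Icc hy.le f.continuous.continuousOn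
    (⟨hcon, hfy.le⟩ : (0 : ℝ) ∈ Set.Icc _ _)
  exact hf w (lt_of_lt_of_le hx hw.1) hw0

/-- If `f + g` and `f + h` both come from `f` by a perturbation that raises the roots, and their
sum is positive on `(ρ, ∞)`, then so is one of them. -/
theorem pos_or_pos_of_add_pos {f g h : ℝ[X]} {ρ : ℝ} (hl : 0 < f.leadingCoeff)
    (hg : g.degree < f.degree) (hh : h.degree < f.degree)
    (hgim : ∀ z : ℂ, 0 < z.im → 0 ≤ (aeval z g / aeval z f).im)
    (hhim : ∀ z : ℂ, 0 < z.im → 0 ≤ (aeval z h / aeval z f).im)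
    (hsum : ∀ x > ρ, 0 < (f + g + (f + h)).eval x) :
    (∀ x > ρ, 0 < (f + g).eval x) ∨ (∀ x > ρ, 0 < (f + h).eval x) := by
  have hf0 : f ≠ 0 := fun h0 => by simp [h0] at hl
  -- Beyond the roots of f the quotient p / f increases to its limit 0 at infinity, so it is
  -- nonpositive there.
  have key : ∀ τ : ℝ, (∀ x > τ, f.eval x ≠ 0) → ∀ p : ℝ[X], p.degree < f.degree →
      (∀ z : ℂ, 0 < z.im → 0 ≤ (aeval z p / aeval z f).im) → ∀ x > τ, p.eval x ≤ 0 := by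
    intro τ hτ p hp him x hx
    have hmono := monotoneOn_div_of_im_nonneg hτ him
    have hlim := div_tendsto_atTop_zero_of_degree_lt p f hp
    have : p.eval x / f.eval x ≤ 0 := by
      refine ge_of_tendsto hlim ?_
      filter_upwards [eventually_ge_atTop x] with y hy
      exact hmono hx (lt_of_lt_of_le hx hy) hy
    have hfx := eval_pos_of_ne_zero hl hτ x hx
    rw [div_le_iff₀ hfx] at this
    simpa using this
  by_cases hroot : ∃ x > ρ, f.eval x = 0
  -- At the largest root of f both perturbations are nonpositive, so 2f + g + h would be nonpositive
  -- at a point beyond ρ.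
  · exfalso
    obtain ⟨x₀, hx₀, hx₀0⟩ := hroot
    have hne : f.roots.toFinset.Nonempty := ⟨x₀, by simp [hf0, hx₀0]⟩
    set τ := f.roots.toFinset.max' hne with hτ
    have hτ0 : f.eval τ = 0 := by
      have := Finset.max'_mem _ hne
      simpa [hf0] using this
    have hτρ : ρ < τ := lt_of_lt_of_le hx₀ (Finset.le_max' _ _ (by simp [hf0, hx₀0]))
    have hτn : ∀ x > τ, f.eval x ≠ 0 := fun x hx h0 =>
      absurd (Finset.le_max' f.roots.toFinset x (by simp [hf0, h0])) (not_le.2 hx)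
    have hle : ∀ p : ℝ[X], (∀ x > τ, p.eval x ≤ 0) → p.eval τ ≤ 0 := fun p hp => by
      refine le_of_tendsto ((p.continuous.tendsto τ).mono_left
        (nhdsWithin_le_nhds (s := Set.Ioi τ))) ?_
      filter_upwards [self_mem_nhdsWithin] with x hx using hp x hx
    have h1 := hle g (key τ hτn g hg hgim)
    have h2 := hle h (key τ hτn h hh hhim)
    have h3 := hsum τ hτρ
    simp only [eval_add, hτ0] at h3
    linarith
  · push Not at hroot
    have hfpos := eval_pos_of_ne_zero hl hroot
    by_contra hcon
    push Not at hcon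
    obtain ⟨⟨x, hx, hx0⟩, y, hy, hy0⟩ := hcon
    -- By monotonicity g / f ≤ -1 at x and h / f ≤ -1 at y both persist at the smaller of the two
    -- points, where the sum would then be nonpositive.
    have hm : ρ < min x y := lt_min hx hy
    have h1 := monotoneOn_div_of_im_nonneg hroot hgim hm hx (min_le_left x y)
    have h2 := monotoneOn_div_of_im_nonneg hroot hhim hm hy (min_le_right x y)
    simp only [eval_add] at hx0 hy0 hsum h1 h2
    have h3 : eval x g / eval x f ≤ -1 := by
      rw [div_le_iff₀ (hfpos x hx)]; linarith
    have h4 : eval y h / eval y f ≤ -1 := by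
      rw [div_le_iff₀ (hfpos y hy)]; linarith
    have h5 := h1.trans h3
    have h6 := h2.trans h4
    rw [div_le_iff₀ (hfpos _ hm)] at h5 h6
    linarith [hsum _ hm]

end XRam

/-! ### Signings and interlacing -/

namespace XRam

open Polynomial

set_option linter.unusedSectionVars false

section Signs

variable {J V : Type*} [Fintype J] [DecidableEq J] [Fintype V] [DecidableEq V]

/-- The sign attached to `e` by the set `S` of negated positions. -/
def sgn {E : Type*} [DecidableEq E] (S : Finset E) (e : E) : ℝ := if e ∈ S then -1 else 1

theorem sgn_mul_self {E : Type*} [DecidableEq E] (S : Finset E) (e : E) :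
    sgn S e * sgn S e = 1 := by
  unfold sgn; split_ifs <;> norm_num

/-- Conjugate the `j`-th matrix of a tuple by the diagonal matrix of the signs `sgn S (j, ·)`. -/
def signFlip (S : Finset (J × V)) (X : J → Matrix V V ℝ) (j : J) : Matrix V V ℝ :=
  Matrix.of fun a b => sgn S (j, a) * sgn S (j, b) * X j a b

/-- Add `s` times the square of the vector `a` to the `j`-th matrix of a tuple. -/
def addSq (X : J → Matrix V V ℝ) (j : J) (s : ℝ) (a : V → ℝ) : J → Matrix V V ℝ :=
  Function.update X j (X j + s • Matrix.vecMulVec a a)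

theorem addSq_isSymm {X : J → Matrix V V ℝ} (hX : ∀ i, (X i).IsSymm) (j : J) (s : ℝ) (a : V → ℝ)
    (i : J) : (addSq X j s a i).IsSymm := by
  unfold addSq
  by_cases hij : i = j
  · subst hij
    simp only [Function.update_self]
    refine (hX i).add (Matrix.IsSymm.smul ?_ s)
    ext a b
    simp [Matrix.vecMulVec_apply, mul_comm]
  · simpa [hij] using hX i

theorem signFlip_isSymm {X : J → Matrix V V ℝ} (hX : ∀ i, (X i).IsSymm) (S : Finset (J × V))
    (i : J) : (signFlip S X i).IsSymm := by
  ext a b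
  simp only [signFlip, Matrix.transpose_apply, Matrix.of_apply, (hX i).apply]
  ring

theorem sum_addSq (X : J → Matrix V V ℝ) (j : J) (s : ℝ) (a : V → ℝ) :
    ∑ i, addSq X j s a i = ∑ i, X i + s • Matrix.vecMulVec a a := by
  unfold addSq
  rw [Finset.sum_update_of_mem (Finset.mem_univ j), ← Finset.add_sum_erase _ X (Finset.mem_univ j),
    Finset.sdiff_singleton_eq_erase]
  abel

theorem trace_sum_addSq (X : J → Matrix V V ℝ) (j : J) (s : ℝ) (a : V → ℝ) :
    ∑ i, (addSq X j s a i).trace = ∑ i, (X i).trace + s * a ⬝ᵥ a := by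
  rw [← Matrix.trace_sum, sum_addSq, Matrix.trace_add, Matrix.trace_sum, Matrix.trace_smul,
    Matrix.trace_vecMulVec, smul_eq_mul]

theorem signFlip_addSq (S : Finset (J × V)) (X : J → Matrix V V ℝ) (j : J) (s : ℝ) (a : V → ℝ) :
    signFlip S (addSq X j s a) = addSq (signFlip S X) j s fun v => sgn S (j, v) * a v := by
  funext i
  ext x y
  by_cases hij : i = j
  · subst hij
    simp [signFlip, addSq, Matrix.vecMulVec_apply]
    ring
  · simp [signFlip, addSq, hij]

theorem trace_signFlip (S : Finset (J × V)) (X : J → Matrix V V ℝ) (j : J) :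
    (signFlip S X j).trace = (X j).trace := by
  simp [Matrix.trace, signFlip, sgn_mul_self]

theorem signFlip_insert {S : Finset (J × V)} {e : J × V} (he : e ∉ S) (X : J → Matrix V V ℝ) :
    signFlip (insert e S) X = signFlip S (signFlip {e} X) := by
  funext j
  ext a b
  have : ∀ x, sgn (insert e S) x = sgn S x * sgn {e} x := by
    intro x
    unfold sgn
    by_cases hx : x = e
    · subst hx; simp [he]
    · simp [hx]
  simp only [signFlip, Matrix.of_apply, this]
  ring

theorem signFlip_empty (X : J → Matrix V V ℝ) : signFlip ∅ X = X := by
  funext j; ext a b; simp [signFlip, sgn]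

/-- A single sign flip is a perturbation of rank two and trace zero. -/
theorem exists_addSq_eq_and_eq {X : J → Matrix V V ℝ} (hX : ∀ i, (X i).IsSymm) (e : J × V) :
    ∃ Y : J → Matrix V V ℝ, (∀ i, (Y i).IsSymm) ∧ ∃ u w : V → ℝ, 0 < u ⬝ᵥ u ∧ 0 < w ⬝ᵥ w ∧
      X = addSq Y e.1 1 u ∧ signFlip {e} X = addSq Y e.1 1 w := by
  obtain ⟨j, v⟩ := e
  -- With r the off-diagonal part of row v, u = e_v + r and w = e_v - r. Then u uᵀ - w wᵀ = 2 (e_v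
  -- rᵀ + r e_vᵀ), which is the difference between the matrix and its flip.
  set u : V → ℝ := fun a => if a = v then 1 else X j v a with hu
  set w : V → ℝ := fun a => if a = v then 1 else -X j v a with hw
  have hpos : ∀ x : V → ℝ, x v = 1 → 0 < x ⬝ᵥ x := fun x hx =>
    Finset.sum_pos' (fun i _ => mul_self_nonneg (x i)) ⟨v, Finset.mem_univ v, by simp [hx]⟩
  refine ⟨addSq X j (-1) u, addSq_isSymm hX j _ _, u, w, hpos u (by simp [hu]),
    hpos w (by simp [hw]), ?_, ?_⟩
  · funext i; ext a b
    by_cases hij : i = j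
    · subst hij; simp [addSq]
    · simp [addSq, hij]
  · funext i; ext a b
    by_cases hij : i = j
    · subst hij
      have hs := (hX i).apply v
      by_cases ha : a = v <;> by_cases hb : b = v <;>
        simp [addSq, signFlip, sgn, Matrix.vecMulVec_apply, hu, hw, ha, hb, hs]
    · simp [addSq, signFlip, sgn, hij]

/-- Polynomials attached to tuples of symmetric matrices that behave like the characteristic
polynomial of the sum: real-rooted, affine along rank-one perturbations, with the right top
coefficients. -/
structure RankOneHyperbolic (Q : (J → Matrix V V ℝ) → ℝ[X]) (κ : ℝ) : Prop where
  pos : 0 < κ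
  natDegree_le : ∀ X, (Q X).natDegree ≤ Fintype.card V
  coeff_card : ∀ X, (Q X).coeff (Fintype.card V) = κ
  coeff_pred : Nonempty V → ∀ X, (Q X).coeff (Fintype.card V - 1) = -κ * ∑ j, (X j).trace
  affine : ∀ X j s a, Q (addSq X j s a) = Q X + C s * (Q (addSq X j 1 a) - Q X)
  ne_zero : ∀ X : J → Matrix V V ℝ, (∀ i, (X i).IsSymm) → ∀ z : ℂ, 0 < z.im → aeval z (Q X) ≠ 0

namespace RankOneHyperbolic

variable {Q : (J → Matrix V V ℝ) → ℝ[X]} {κ : ℝ}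

/-- Equal top coefficients lower the degree of the difference, the trace formula gives it the
negative coefficient -κ (a ⬝ᵥ a), and affinity identifies the pencil f + s g with Q at rank-one
updates, which has no zeros in the upper half-plane. This is the input of `im_div_pos_of_ne_zero`.
-/
theorem addSq_sub (hQ : RankOneHyperbolic Q κ) (v : V) {X : J → Matrix V V ℝ}
    (hX : ∀ i, (X i).IsSymm) (j : J) {a : V → ℝ} (ha : 0 < a ⬝ᵥ a) :
    (Q (addSq X j 1 a) - Q X).degree < (Q X).degree ∧
    ∀ z : ℂ, 0 < z.im → 0 < (aeval z (Q (addSq X j 1 a) - Q X) / aeval z (Q X)).im := by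
  obtain ⟨N, hN⟩ : ∃ N, Fintype.card V = N + 1 :=
    ⟨_, (Nat.succ_pred_eq_of_pos (Fintype.card_pos_iff.2 ⟨v⟩)).symm⟩
  have hnd := hQ.natDegree_le
  have hc := hQ.coeff_card
  have hcp := hQ.coeff_pred ⟨v⟩
  rw [hN] at hnd hc hcp
  have hgd : (Q (addSq X j 1 a) - Q X).natDegree ≤ N := by
    rw [natDegree_le_iff_coeff_eq_zero]
    intro k hk
    rcases (Nat.succ_le_of_lt hk).eq_or_lt with rfl | hk
    · simp [hc]
    · rw [coeff_sub, coeff_eq_zero_of_natDegree_lt ((hnd _).trans_lt hk),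
        coeff_eq_zero_of_natDegree_lt ((hnd _).trans_lt hk), sub_zero]
  refine ⟨?_, im_div_pos_of_ne_zero (N := N) (hnd X) ((hc X).symm ▸ hQ.pos) hgd ?_ ?_⟩
  · have : (Q X).degree = ((N + 1 : ℕ) : WithBot ℕ) := by
      refine le_antisymm (natDegree_le_iff_degree_le.1 (hnd X)) (le_degree_of_ne_zero ?_)
      rw [hc]; exact hQ.pos.ne'
    rw [this]
    exact (natDegree_le_iff_degree_le.1 hgd).trans_lt (by exact_mod_cast Nat.lt_succ_self N)
  · simp only [coeff_sub]
    rw [show N = N + 1 - 1 from rfl, hcp, hcp, trace_sum_addSq]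
    nlinarith [mul_pos hQ.pos ha]
  · intro s z hz
    rw [← hQ.affine]
    exact hQ.ne_zero _ (addSq_isSymm hX j s a) z hz

/-- The point is zero-freeness. With Y the common part of X and its flip, a zero of the sum would
make two quotients over Q Y add up to -2, although both have positive imaginary part. The other
fields survive because a flip preserves traces and sends a rank-one update to one by a re-signed
vector. -/
theorem add_signFlip (hQ : RankOneHyperbolic Q κ) (e : J × V) :
    RankOneHyperbolic (fun X => Q X + Q (signFlip {e} X)) (2 * κ) where
  pos := by linarith [hQ.pos]
  natDegree_le X := (natDegree_add_le _ _).trans (max_le (hQ.natDegree_le _) (hQ.natDegree_le _))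
  coeff_card X := by rw [coeff_add, hQ.coeff_card, hQ.coeff_card]; ring
  coeff_pred h X := by
    rw [coeff_add, hQ.coeff_pred h, hQ.coeff_pred h]
    simp only [trace_signFlip]
    ring
  affine X j s a := by
    simp only [signFlip_addSq]
    rw [hQ.affine X, hQ.affine (signFlip {e} X)]
    ring
  ne_zero X hX z hz := by
    obtain ⟨Y, hY, u, w, hu, hw, h1, h2⟩ := exists_addSq_eq_and_eq hX e
    simp only [h2]
    rw [h1]
    have hu' := (hQ.addSq_sub e.2 hY e.1 hu).2 z hz
    have hw' := (hQ.addSq_sub e.2 hY e.1 hw).2 z hz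
    have hne := hQ.ne_zero Y hY z hz
    intro h0
    have : (aeval z (Q (addSq Y e.1 1 u) - Q Y) / aeval z (Q Y)) +
        (aeval z (Q (addSq Y e.1 1 w) - Q Y) / aeval z (Q Y)) = ((-2 : ℝ) : ℂ) := by
      rw [map_add] at h0
      rw [← add_div, div_eq_iff hne, map_sub, map_sub]
      push_cast
      linear_combination h0
    have := congrArg Complex.im this
    rw [Complex.add_im, Complex.ofReal_im] at this
    linarith

theorem pos_or_pos (hQ : RankOneHyperbolic Q κ) (e : J × V) {X : J → Matrix V V ℝ}
    (hX : ∀ i, (X i).IsSymm) {ρ : ℝ} (h : ∀ x > ρ, 0 < (Q X + Q (signFlip {e} X)).eval x) :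
    (∀ x > ρ, 0 < (Q X).eval x) ∨ ∀ x > ρ, 0 < (Q (signFlip {e} X)).eval x := by
  obtain ⟨Y, hY, u, w, hu, hw, h1, h2⟩ := exists_addSq_eq_and_eq hX e
  have hu' := hQ.addSq_sub e.2 hY e.1 hu
  have hw' := hQ.addSq_sub e.2 hY e.1 hw
  have hl : 0 < (Q Y).leadingCoeff := by
    have hc := hQ.coeff_card Y
    rw [leadingCoeff, le_antisymm (hQ.natDegree_le Y)
      (le_natDegree_of_ne_zero (by rw [hc]; exact hQ.pos.ne')), hc]
    exact hQ.pos
  have := pos_or_pos_of_add_pos (ρ := ρ) hl hu'.1 hw'.1 (fun z hz => (hu'.2 z hz).le)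
    (fun z hz => (hw'.2 z hz).le)
  rw [add_sub_cancel, add_sub_cancel, ← h1, ← h2] at this
  exact this h

end RankOneHyperbolic

/-- The matrix determinant lemma gives an expression affine in s at every x that is not an
eigenvalue of B; infinitely many such x determine the polynomials. -/
theorem charpoly_add_smul_vecMulVec (B : Matrix V V ℝ) (s : ℝ) (a : V → ℝ) :
    (B + s • Matrix.vecMulVec a a).charpoly =
      B.charpoly + C s * ((B + (1 : ℝ) • Matrix.vecMulVec a a).charpoly - B.charpoly) := by
  have key : ∀ x : ℝ, B.charpoly.eval x ≠ 0 → ∀ s : ℝ,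
      (B + s • Matrix.vecMulVec a a).charpoly.eval x = B.charpoly.eval x *
        (1 - s * (a ⬝ᵥ ((Matrix.scalar V x - B)⁻¹.mulVec a))) := by
    intro x hx s
    rw [Matrix.eval_charpoly] at hx ⊢
    have h1 : Matrix.scalar V x - (B + s • Matrix.vecMulVec a a) = (Matrix.scalar V x - B) +
        Matrix.replicateCol Unit ((-s) • a) * Matrix.replicateRow Unit a := by
      ext i k
      simp [Matrix.mul_apply, Matrix.vecMulVec_apply]
      ring
    rw [h1, Matrix.det_add_replicateCol_mul_replicateRow (Ne.isUnit hx), Matrix.eval_charpoly]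
    congr 1
    rw [Matrix.det_unique, Matrix.add_apply, Matrix.one_apply_eq, Matrix.mul_assoc,
      ← Matrix.replicateCol_mulVec, Matrix.replicateRow_mul_replicateCol_apply, Matrix.mulVec_smul,
      dotProduct_smul, smul_eq_mul]
    ring
  refine Polynomial.eq_of_infinite_eval_eq _ _ ?_
  have hinf : {x : ℝ | B.charpoly.eval x ≠ 0}.Infinite := by
    have : {x : ℝ | B.charpoly.eval x = 0}.Finite := by
      refine (Polynomial.finite_setOfPred_isRoot (Matrix.charpoly_monic B).ne_zero)
    exact this.infinite_compl
  refine hinf.mono fun x hx => ?_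
  simp only [Set.mem_ofPred_eq, eval_add, eval_mul, eval_C, eval_sub]
  rw [key x hx, key x hx]
  ring

theorem rankOneHyperbolic_charpoly_sum :
    RankOneHyperbolic (fun X : J → Matrix V V ℝ => (∑ j, X j).charpoly) 1 where
  pos := one_pos
  natDegree_le X := by rw [Matrix.charpoly_natDegree_eq_dim]
  coeff_card X := by
    have := Matrix.charpoly_monic (∑ j, X j)
    rwa [Monic, leadingCoeff, Matrix.charpoly_natDegree_eq_dim] at this
  coeff_pred h X := by
    have := Matrix.trace_eq_neg_charpoly_coeff (∑ j, X j)
    rw [← Matrix.trace_sum, this]; ring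
  affine X j s a := by
    simp only [sum_addSq]
    exact charpoly_add_smul_vecMulVec _ s a
  ne_zero X hX z hz := by
    have hH : (∑ j, X j).IsHermitian := by
      rw [Matrix.IsHermitian, Matrix.conjTranspose_sum]
      exact Finset.sum_congr rfl fun j _ => by
        rw [Matrix.conjTranspose_eq_transpose_of_trivial, (hX j).eq]
    rw [hH.charpoly_eq, map_prod, Finset.prod_ne_zero_iff]
    intro i _ h0
    have := congrArg Complex.im h0
    simp at this
    exact hz.ne' this

theorem sum_powerset_insert_signFlip (Q : (J → Matrix V V ℝ) → ℝ[X]) {s : Finset (J × V)}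
    {e : J × V} (he : e ∉ s) (X : J → Matrix V V ℝ) :
    ∑ S ∈ (insert e s).powerset, Q (signFlip S X) =
      ∑ S ∈ s.powerset, Q (signFlip S X) + ∑ S ∈ s.powerset, Q (signFlip S (signFlip {e} X)) := by
  rw [Finset.sum_powerset_insert he]
  congr 1
  refine Finset.sum_congr rfl fun S hS => ?_
  rw [signFlip_insert fun h => he (Finset.mem_powerset.1 hS h)]

theorem RankOneHyperbolic.sum_powerset {Q : (J → Matrix V V ℝ) → ℝ[X]} {κ : ℝ}
    (hQ : RankOneHyperbolic Q κ) (s : Finset (J × V)) :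
    ∃ κ', RankOneHyperbolic (fun X => ∑ S ∈ s.powerset, Q (signFlip S X)) κ' := by
  induction s using Finset.induction_on with
  | empty => exact ⟨κ, by simpa [signFlip_empty] using hQ⟩
  | insert e s he ih =>
    obtain ⟨κ', h⟩ := ih
    simp only [sum_powerset_insert_signFlip Q he]
    exact ⟨_, h.add_signFlip e⟩

/-- Signs are fixed one position at a time: the sum over the positions still undecided is again
rank-one hyperbolic, so one of the two choices keeps positivity beyond ρ. -/
theorem RankOneHyperbolic.exists_pos {Q : (J → Matrix V V ℝ) → ℝ[X]} {κ : ℝ}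
    (hQ : RankOneHyperbolic Q κ) {ρ : ℝ} (s : Finset (J × V)) :
    ∀ X : J → Matrix V V ℝ, (∀ i, (X i).IsSymm) →
      (∀ x > ρ, 0 < (∑ S ∈ s.powerset, Q (signFlip S X)).eval x) →
      ∃ S ⊆ s, ∀ x > ρ, 0 < (Q (signFlip S X)).eval x := by
  induction s using Finset.induction_on with
  | empty => exact fun X _ h => ⟨∅, subset_rfl, by simpa using h⟩
  | insert e s he ih =>
    intro X hX h
    obtain ⟨κ', hs⟩ := hQ.sum_powerset s
    rw [sum_powerset_insert_signFlip Q he] at h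
    rcases hs.pos_or_pos e hX h with h | h
    · obtain ⟨S, hS, hpos⟩ := ih X hX h
      exact ⟨S, hS.trans (Finset.subset_insert e s), hpos⟩
    · obtain ⟨S, hS, hpos⟩ := ih _ (signFlip_isSymm hX _) h
      refine ⟨insert e S, Finset.insert_subset_insert e hS, ?_⟩
      rwa [signFlip_insert fun h => he (hS h)]

/-- If the average of the characteristic polynomials of all signings is positive on `(ρ, ∞)`, then
so is the characteristic polynomial of some signing. -/
theorem exists_signFlip_charpoly_pos {X : J → Matrix V V ℝ} (hX : ∀ i, (X i).IsSymm) {ρ : ℝ}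
    (h : ∀ x > ρ, 0 < ∑ S : Finset (J × V), (∑ j, signFlip S X j).charpoly.eval x) :
    ∃ S : Finset (J × V), ∀ x > ρ, 0 < (∑ j, signFlip S X j).charpoly.eval x := by
  obtain ⟨S, -, hS⟩ := rankOneHyperbolic_charpoly_sum.exists_pos (ρ := ρ) Finset.univ X hX
    (by simpa [eval_finsetSum] using h)
  exact ⟨S, hS⟩

end Signs

end XRam

/-! ### Principal minors and their averages over signings -/

namespace XRam

section PrincipalMinors

variable {V R : Type*} [Fintype V] [DecidableEq V] [CommRing R]

/-- The principal minor of `B` with rows and columns in `W`. -/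
def principalMinor (B : Matrix V V R) (W : Finset V) : R :=
  Matrix.det (Matrix.of fun i j => if i ∈ W then B i j else (1 : Matrix V V R) i j)

/-- The generating function of the paths from `u` to `v` through `W` in the matrix `B`, weighted
by the complementary minors: up to sign, the minor of `B` on `W` after replacing the column of `u`
by the column of `v`. -/
def pathMinor (B : Matrix V V R) (W : Finset V) (u v : V) : R :=
  -principalMinor (B.submatrix id (Equiv.swap u v)) W

theorem principalMinor_eq_det_submatrix (B : Matrix V V R) (W : Finset V) :
    principalMinor B W = (B.submatrix (Subtype.val : {i // i ∈ W} → V) Subtype.val).det := by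
  rw [principalMinor, ← Matrix.det_piecewise_one_eq_submatrix_det B W]
  congr 1
  ext i j
  by_cases hi : i ∈ W <;> simp [hi, Finset.piecewise]

theorem principalMinor_congr {B B' : Matrix V V R} {W : Finset V}
    (h : ∀ i ∈ W, ∀ j ∈ W, B i j = B' i j) : principalMinor B W = principalMinor B' W := by
  rw [principalMinor_eq_det_submatrix, principalMinor_eq_det_submatrix]
  congr 1
  ext i j
  exact h i i.2 j j.2

theorem principalMinor_univ (B : Matrix V V R) : principalMinor B Finset.univ = B.det := by
  simp only [principalMinor, Finset.mem_univ, if_true]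
  rfl

theorem principalMinor_empty (B : Matrix V V R) : principalMinor B ∅ = 1 := by
  simp only [principalMinor, Finset.notMem_empty, if_false]
  exact Matrix.det_one

/-- Expansion along row u. In the cofactor of an off-diagonal entry in column w, exchanging columns
w and u restores a principal minor at the cost of a sign, the one built into `pathMinor`. -/
theorem principalMinor_eq_add_sum (B : Matrix V V R) {W : Finset V} {u : V} (hu : u ∈ W) :
    principalMinor B W = B u u * principalMinor B (W.erase u) +
      ∑ w ∈ W.erase u, B u w * pathMinor B (W.erase u) w u := by
  set C : Matrix V V R := Matrix.of fun i j => if i ∈ W then B i j else (1 : Matrix V V R) i j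
    with hC
  have hrow : ∀ w, C.adjugate w u = if w = u then principalMinor B (W.erase u) else
      if w ∈ W then pathMinor B (W.erase u) w u else 0 := by
    intro w
    rw [Matrix.adjugate_apply]
    split_ifs with hwu hwW
    · subst hwu
      unfold principalMinor
      congr 1
      ext i j
      by_cases hi : i = w
      · subst hi; simp [Matrix.one_apply, Pi.single_apply, eq_comm]
      · simp [hC, hi]
    · unfold pathMinor principalMinor
      rw [← neg_one_mul, eq_comm]
      have hswap := Matrix.det_permute' (Equiv.swap w u) (C.updateRow u (Pi.single w 1))
      rw [Equiv.Perm.sign_swap hwu] at hswap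
      have : ((C.updateRow u (Pi.single w 1)).submatrix id (Equiv.swap w u)) =
          Matrix.of fun i j => if i ∈ W.erase u then (B.submatrix id (Equiv.swap w u)) i j else
            (1 : Matrix V V R) i j := by
        ext i j
        by_cases hi : i = u
        · subst hi
          by_cases hj : j = i
          · subst hj; simp
          · have : Equiv.swap w i j ≠ w := by
              rw [Ne, Equiv.swap_apply_eq_iff]; simpa using hj
            simp [this, Matrix.one_apply, Ne.symm hj]
        · simp only [Matrix.submatrix_apply, id, Matrix.updateRow_ne hi, hC, Matrix.of_apply,
            Finset.mem_erase, ne_eq, hi, not_false_eq_true, true_and]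
          by_cases hiW : i ∈ W
          · simp [hiW]
          · simp only [hiW, if_false, Matrix.one_apply]
            congr 1
            have hiw : i ≠ w := fun h => hiW (h ▸ hwW)
            rw [eq_comm (b := Equiv.swap w u j), Equiv.swap_apply_eq_iff,
              Equiv.swap_apply_of_ne_of_ne hiw hi]
            exact propext eq_comm
      rw [← this, hswap]
      simp
    -- For w outside W, rows w and u of the updated matrix are both the unit vector at w.
    · refine Matrix.det_zero_of_row_eq (i := w) (j := u) hwu ?_
      ext j
      simp [Matrix.updateRow_ne hwu, hC, hwW, Matrix.one_apply, Pi.single_apply, eq_comm]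
  rw [principalMinor, ← hC, Matrix.det_eq_sum_mul_adjugate_row C u,
    ← Finset.add_sum_erase _ _ (Finset.mem_univ u)]
  congr 1
  · rw [hrow, if_pos rfl]; simp [hC, hu]
  · rw [← Finset.sum_subset (Finset.erase_subset_erase u (Finset.subset_univ W))]
    · refine Finset.sum_congr rfl fun w hw => ?_
      rw [Finset.mem_erase] at hw
      rw [hrow, if_neg hw.1, if_pos hw.2]; simp [hC, hu]
    · intro w hw hw'
      simp only [Finset.mem_erase, Finset.mem_univ, and_true, not_and] at hw hw'
      rw [hrow, if_neg hw, if_neg (hw' hw), mul_zero]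

/-- As v is not in W, the swap only puts column v in the place of column u; expanding along row u
then separates the first step of the path. For B = x - M the minus signs cancel, leaving a sum over
self-avoiding paths weighted by M. -/
theorem pathMinor_eq (B : Matrix V V R) {W : Finset V} {u v : V} (hu : u ∈ W) (hv : v ∉ W) :
    pathMinor B W u v = -(B u v * principalMinor B (W.erase u)) -
      ∑ w ∈ W.erase u, B u w * pathMinor B (W.erase u) w v := by
  have hne : ∀ {j}, j ∈ W.erase u → j ≠ u ∧ j ≠ v := fun {j} hj =>
    ⟨Finset.ne_of_mem_erase hj, fun h => hv (h ▸ Finset.mem_of_mem_erase hj)⟩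
  have hsw : ∀ {j}, j ∈ W.erase u → Equiv.swap u v j = j := fun {j} hj =>
    Equiv.swap_apply_of_ne_of_ne (hne hj).1 (hne hj).2
  rw [pathMinor, principalMinor_eq_add_sum _ hu, neg_add, ← sub_eq_add_neg]
  congr 1
  · rw [principalMinor_congr (B' := B) fun i _ j hj => by simp [hsw hj]]
    simp
  · refine Finset.sum_congr rfl fun w hw => ?_
    congr 1
    · simp [hsw hw]
    · unfold pathMinor
      rw [principalMinor_congr]
      intro i _ j hj
      simp only [Matrix.submatrix_apply, id]
      congr 1
      by_cases hjw : j = w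
      · subst hjw; simp
      · rw [Equiv.swap_apply_of_ne_of_ne hjw (hne hj).1, hsw hj,
          Equiv.swap_apply_of_ne_of_ne hjw (hne hj).2]

theorem pathMinor_congr {B B' : Matrix V V R} {W : Finset V} {u v : V} (hu : u ∈ W)
    (h : ∀ i ∈ W, ∀ j, j ∈ W ∨ j = v → B i j = B' i j) : pathMinor B W u v = pathMinor B' W u v := by
  unfold pathMinor
  rw [principalMinor_congr]
  intro i hi j hj
  refine h i hi _ ?_
  rw [Equiv.swap_apply_def]
  split_ifs <;> simp_all

end PrincipalMinors

/-! ### Averaging over signings: only monochromatic paths survive -/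

section Average

variable {J V : Type*} [Fintype J] [DecidableEq J] [Fintype V] [DecidableEq V]

/-- Toggling e pairs the sets S into terms that cancel. -/
theorem sum_sgn_mul_eq_zero {E : Type*} [Fintype E] [DecidableEq E] (e : E) (f : Finset E → ℝ)
    (hf : ∀ S, f (symmDiff S {e}) = f S) : ∑ S, sgn S e * f S = 0 := by
  have hinv : Function.Involutive fun S : Finset E => symmDiff S {e} := fun S => by
    simp
  have h := Equiv.sum_comp hinv.toPerm fun S => sgn S e * f S
  have h2 : ∀ S : Finset E, sgn (symmDiff S {e}) e = -sgn S e := by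
    intro S
    unfold sgn
    by_cases he : e ∈ S <;> simp [Finset.mem_symmDiff, he]
  simp only [Function.Involutive.coe_toPerm, h2, hf, neg_mul, Finset.sum_neg_distrib] at h
  linarith

theorem sgn_symmDiff_of_ne {E : Type*} [DecidableEq E] (S : Finset E) {e e' : E} (h : e' ≠ e) :
    sgn (symmDiff S {e}) e' = sgn S e' := by
  simp [sgn, Finset.mem_symmDiff, h]

/-- The matrix `x - ∑ⱼ Dⱼ Aⱼ Dⱼ` for the signing `S`. -/
noncomputable def signedResolvent (A : J → Matrix V V ℝ) (x : ℝ) (S : Finset (J × V)) :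
    Matrix V V ℝ :=
  Matrix.scalar V x - ∑ j, signFlip S A j

/-- The sum of a principal minor over all signings. -/
noncomputable def signedMinorSum (A : J → Matrix V V ℝ) (x : ℝ) (W : Finset V) : ℝ :=
  ∑ S : Finset (J × V), principalMinor (signedResolvent A x S) W

/-- The part of colour `j` of the sum of a path minor over all signings. -/
noncomputable def signedPathSum (A : J → Matrix V V ℝ) (x : ℝ) (j : J) (W : Finset V) (u v : V) :
    ℝ :=
  ∑ S : Finset (J × V), sgn S (j, u) * sgn S (j, v) * pathMinor (signedResolvent A x S) W u v

theorem signedResolvent_apply_ne (A : J → Matrix V V ℝ) (x : ℝ) (S : Finset (J × V)) {u v : V}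
    (h : u ≠ v) :
    signedResolvent A x S u v = -∑ i, sgn S (i, u) * sgn S (i, v) * A i u v := by
  simp [signedResolvent, signFlip, Matrix.sum_apply, Matrix.diagonal_apply_ne _ h]

theorem signedResolvent_apply_self (A : J → Matrix V V ℝ) (x : ℝ) (S : Finset (J × V)) (u : V)
    (h : ∀ i, A i u u = 0) : signedResolvent A x S u u = x := by
  simp [signedResolvent, signFlip, Matrix.sum_apply, h]

theorem signedResolvent_symmDiff (A : J → Matrix V V ℝ) (x : ℝ) (S : Finset (J × V)) (j : J)
    {u a b : V} (ha : a ≠ u) (hb : b ≠ u) :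
    signedResolvent A x (symmDiff S {(j, u)}) a b = signedResolvent A x S a b := by
  simp only [signedResolvent, Matrix.sub_apply, Matrix.sum_apply, signFlip, Matrix.of_apply]
  congr 1
  refine Finset.sum_congr rfl fun i _ => ?_
  rw [sgn_symmDiff_of_ne, sgn_symmDiff_of_ne]
  · simp [hb]
  · simp [ha]

theorem signedMinorSum_eq (A : J → Matrix V V ℝ) (x : ℝ) {W : Finset V} {v : V} (hv : v ∈ W)
    (hdiag : ∀ i, A i v v = 0) :
    signedMinorSum A x W = x * signedMinorSum A x (W.erase v) -
      ∑ j, ∑ u ∈ W.erase v, A j v u * signedPathSum A x j (W.erase v) u v := by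
  unfold signedMinorSum signedPathSum
  simp only [principalMinor_eq_add_sum _ hv, signedResolvent_apply_self A x _ v hdiag]
  rw [Finset.sum_add_distrib, ← Finset.mul_sum, sub_eq_add_neg]
  congr 1
  rw [Finset.sum_comm, Finset.sum_comm (s := (Finset.univ : Finset J)), ← Finset.sum_neg_distrib]
  refine Finset.sum_congr rfl fun u hu => ?_
  simp only [Finset.mul_sum]
  rw [Finset.sum_comm, ← Finset.sum_neg_distrib]
  refine Finset.sum_congr rfl fun S _ => ?_
  rw [signedResolvent_apply_ne A x S (Finset.ne_of_mem_erase hu).symm, neg_mul, Finset.sum_mul]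
  congr 1
  refine Finset.sum_congr rfl fun i _ => ?_
  ring

/-- For i = j the sign at (j, u) appears squared. For i ≠ j it appears exactly once while nothing
else depends on it, so the term averages to zero. -/
theorem sum_sgn_mul_sgn (A : J → Matrix V V ℝ) (j : J) {u v w : V} (hu : v ≠ u) (hw : w ≠ u)
    (f : Finset (J × V) → ℝ) (hf : ∀ S, f (symmDiff S {(j, u)}) = f S) :
    ∑ S, sgn S (j, u) * sgn S (j, v) * ((∑ i, sgn S (i, u) * sgn S (i, w) * A i u w) * f S) =
      A j u w * ∑ S, sgn S (j, w) * sgn S (j, v) * f S := by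
  simp only [Finset.sum_mul, Finset.mul_sum]
  rw [Finset.sum_comm, Finset.sum_eq_single j]
  · refine Finset.sum_congr rfl fun S _ => ?_
    linear_combination (sgn S (j, v) * sgn S (j, w) * A j u w * f S) * sgn_mul_self S (j, u)
  · intro i _ hij
    rw [← sum_sgn_mul_eq_zero (j, u)
      fun S => sgn S (j, v) * (sgn S (i, u) * sgn S (i, w) * A i u w * f S)]
    · exact Finset.sum_congr rfl fun S _ => by ring
    · intro S
      rw [hf, sgn_symmDiff_of_ne, sgn_symmDiff_of_ne, sgn_symmDiff_of_ne]
      all_goals simp [hu, hw, hij]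
  · simp

/-- The same recursion as for a path minor, except that a path begun in colour j has to continue in
colour j. This is what makes the averaged minors comparable with the tree-like arrangement of atoms
in the additive product. -/
theorem signedPathSum_eq (A : J → Matrix V V ℝ) (x : ℝ) (j : J) {W : Finset V} {u v : V}
    (hu : u ∈ W) (hv : v ∉ W) :
    signedPathSum A x j W u v = A j u v * signedMinorSum A x (W.erase u) +
      ∑ w ∈ W.erase u, A j u w * signedPathSum A x j (W.erase u) w v := by
  have huv : v ≠ u := fun h => hv (h ▸ hu)
  unfold signedPathSum signedMinorSum
  simp only [pathMinor_eq _ hu hv, signedResolvent_apply_ne A x _ huv.symm]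
  simp only [neg_mul, neg_neg, mul_sub, Finset.sum_sub_distrib]
  rw [sub_eq_add_neg]
  congr 1
  · rw [sum_sgn_mul_sgn A j huv huv]
    · simp [sgn_mul_self]
    · intro S
      exact principalMinor_congr fun a ha b hb => signedResolvent_symmDiff A x S j
        (Finset.ne_of_mem_erase ha) (Finset.ne_of_mem_erase hb)
  · simp only [Finset.mul_sum]
    rw [Finset.sum_comm, ← Finset.sum_neg_distrib]
    refine Finset.sum_congr rfl fun w hw => ?_
    have hwu := Finset.ne_of_mem_erase hw
    rw [← Finset.mul_sum, ← sum_sgn_mul_sgn A j huv hwu, ← Finset.sum_neg_distrib]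
    · refine Finset.sum_congr rfl fun S _ => ?_
      rw [signedResolvent_apply_ne A x S hwu.symm]
      ring
    · intro S
      refine pathMinor_congr hw fun a ha b hb => signedResolvent_symmDiff A x S j
        (Finset.ne_of_mem_erase ha) ?_
      rcases hb with hb | rfl
      exacts [Finset.ne_of_mem_erase hb, huv]

end Average

end XRam

/-! ### Comparison with a finite part of a covering graph -/

namespace XRam

set_option linter.unusedSectionVars false

section Comparison

variable {J V Y K : Type*} [Fintype J] [DecidableEq J] [Fintype V] [DecidableEq V]
  [Fintype Y] [DecidableEq Y] [DecidableEq K]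

/-- A finite weighted graph `P` with a map `f` to the vertices of the coloured graph `A` along
which coloured edges lift, up to distance `L` from the root. The vertices `s` and `t` lie in the
same copy of an atom of colour `j` if `key j s = key j t`. -/
structure LiftsTo (A : J → Matrix V V ℝ) (P : Matrix Y Y ℝ) (f : Y → V) (key : J → Y → K)
    (depth : Y → ℕ) (L : ℕ) : Prop where
  nonneg : ∀ j a b, 0 ≤ A j a b
  diag : ∀ j a, A j a a = 0
  diag' : ∀ s, P s s = 0
  sum_le : ∀ s t, ∑ j, (if key j s = key j t then A j (f s) (f t) else 0) ≤ P s t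
  lift : ∀ s j b, depth s < L → A j (f s) b ≠ 0 →
    ∃ t, key j s = key j t ∧ f t = b ∧ depth t ≤ depth s + 1

namespace LiftsTo

variable {A : J → Matrix V V ℝ} {P : Matrix Y Y ℝ} {f : Y → V} {key : J → Y → K}
  {depth : Y → ℕ} {L : ℕ}

theorem ite_nonneg (h : LiftsTo A P f key depth L) (s t : Y) (j : J) :
    0 ≤ if key j s = key j t then A j (f s) (f t) else 0 := by
  split_ifs
  exacts [h.nonneg _ _ _, le_rfl]

theorem ite_le (h : LiftsTo A P f key depth L) (s t : Y) (j : J) :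
    (if key j s = key j t then A j (f s) (f t) else 0) ≤ P s t :=
  (Finset.single_le_sum (fun i _ => h.ite_nonneg s t i) (Finset.mem_univ j)).trans (h.sum_le s t)

theorem weight_nonneg (h : LiftsTo A P f key depth L) (s t : Y) : 0 ≤ P s t :=
  (Finset.sum_nonneg fun i _ => h.ite_nonneg s t i).trans (h.sum_le s t)

theorem scalar_sub_apply_ne (P : Matrix Y Y ℝ) (x : ℝ) {s t : Y} (hst : s ≠ t) :
    (Matrix.scalar Y x - P) s t = -P s t := by
  simp [Matrix.diagonal_apply_ne _ hst]

theorem pathMinor_nonneg (h : LiftsTo A P f key depth L) {x : ℝ}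
    (hpos : ∀ Z, 0 < principalMinor (Matrix.scalar Y x - P) Z) (s : Y) :
    ∀ (Z : Finset Y) (t : Y), s ∉ Z → t ∈ Z → 0 ≤ pathMinor (Matrix.scalar Y x - P) Z t s := by
  intro Z
  induction Z using Finset.strongInduction with
  | H Z ih =>
    intro t hs ht
    rw [pathMinor_eq _ ht hs, scalar_sub_apply_ne P x (s := t) (t := s) (fun e => hs (e ▸ ht)), neg_mul,
      neg_neg,
      sub_eq_add_neg, ← Finset.sum_neg_distrib]
    refine add_nonneg (mul_nonneg (h.weight_nonneg _ _) (hpos _).le) (Finset.sum_nonneg ?_)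
    intro r hr
    rw [scalar_sub_apply_ne P x (Finset.ne_of_mem_erase hr).symm, neg_mul, neg_neg]
    exact mul_nonneg (h.weight_nonneg _ _)
      (ih _ (Finset.erase_ssubset ht) r (fun h => hs (Finset.mem_of_mem_erase h)) hr)

/-- Each neighbour u is lifted to one vertex in the copy of the atom containing s. Different u have
different lifts, and the unused terms on the right are nonnegative. -/
theorem sum_mul_le (h : LiftsTo A P f key depth L) {s : Y} {j : J} {W : Finset V} {Z : Finset Y}
    (hZ : ∀ t, f t ∈ W → t ∈ Z) (hs : depth s < L) {F : V → ℝ} {G : Y → ℝ}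
    (hG : ∀ t ∈ Z, 0 ≤ G t)
    (hFG : ∀ t, f t ∈ W → key j s = key j t → depth t ≤ depth s + 1 → F (f t) ≤ G t) :
    ∑ u ∈ W, A j (f s) u * F u ≤
      ∑ t ∈ Z, (if key j s = key j t then A j (f s) (f t) else 0) * G t := by
  classical
  have hl : ∀ u : V, ∃ t, A j (f s) u ≠ 0 → key j s = key j t ∧ f t = u ∧ depth t ≤ depth s + 1 := by
    intro u
    by_cases hu : A j (f s) u = 0
    · exact ⟨s, fun h => absurd hu h⟩
    · obtain ⟨t, ht⟩ := h.lift s j u hs hu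
      exact ⟨t, fun _ => ht⟩
  choose g hg using hl
  rw [← Finset.sum_filter_of_ne (p := fun u => A j (f s) u ≠ 0) (s := W) fun u _ hu =>
    left_ne_zero_of_mul hu]
  have hinj : Set.InjOn g (W.filter fun u => A j (f s) u ≠ 0) := by
    intro a ha b hb hab
    rw [← (hg a (Finset.mem_filter.1 ha).2).2.1, ← (hg b (Finset.mem_filter.1 hb).2).2.1, hab]
  have hsub : (W.filter fun u => A j (f s) u ≠ 0).image g ⊆ Z := by
    intro t ht
    obtain ⟨u, hu, rfl⟩ := Finset.mem_image.1 ht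
    have hu' := Finset.mem_filter.1 hu
    exact hZ _ (by rw [(hg u hu'.2).2.1]; exact hu'.1)
  refine le_trans ?_ (Finset.sum_le_sum_of_subset_of_nonneg hsub fun t ht _ =>
    mul_nonneg (h.ite_nonneg s t j) (hG t ht))
  rw [Finset.sum_image hinj]
  refine Finset.sum_le_sum fun u hu => ?_
  obtain ⟨hu, hu0⟩ := Finset.mem_filter.1 hu
  obtain ⟨h1, h2, h3⟩ := hg u hu0
  rw [if_pos h1]
  have := hFG (g u) (by rwa [h2]) h1 h3
  rw [h2] at this ⊢
  exact mul_le_mul_of_nonneg_left this (h.nonneg _ _ _)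

/-- Read as quotients (where the denominators are positive), the first claim bounds α(W \ f s) /
α(W) by D(Z \ s) / D(Z), the diagonal Green function of the region Z at s; here α is the averaged
minor and D the minor of x - P. Both sides satisfy the path recursion, but P contains lifts of all
monochromatic steps and Z contains the whole preimage of W, so the right side is larger. The claim
on paths is proved simultaneously, since each recursion calls the other. Every step removes one
vertex of W and increases the depth by at most one, whence the condition depth + |W| ≤ L. -/
theorem comparison (h : LiftsTo A P f key depth L) {x : ℝ}
    (hpos : ∀ Z, 0 < principalMinor (Matrix.scalar Y x - P) Z) (W : Finset V)
    (hα : ∀ W' ⊂ W, 0 ≤ signedMinorSum A x W') :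
    (∀ (Z : Finset Y) (s : Y), s ∈ Z → f s ∈ W → (∀ t, f t ∈ W → t ∈ Z) → depth s + W.card ≤ L →
      signedMinorSum A x (W.erase (f s)) * principalMinor (Matrix.scalar Y x - P) Z ≤
        signedMinorSum A x W * principalMinor (Matrix.scalar Y x - P) (Z.erase s)) ∧
    ∀ (Z : Finset Y) (s t : Y) (j : J), s ∉ Z → t ∈ Z → f s ∉ W → f t ∈ W → key j s = key j t →
      (∀ t, f t ∈ W → t ∈ Z) → depth t + W.card ≤ L →
      signedPathSum A x j W (f t) (f s) * principalMinor (Matrix.scalar Y x - P) Z ≤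
        signedMinorSum A x W * pathMinor (Matrix.scalar Y x - P) Z t s := by
  induction W using Finset.strongInduction with
  | H W ih =>
  have herase : ∀ {Z : Finset Y} {s : Y}, (∀ t, f t ∈ W → t ∈ Z) →
      ∀ t, f t ∈ W.erase (f s) → t ∈ Z.erase s := fun {Z s} hZ t ht =>
    Finset.mem_erase.2 ⟨fun h => Finset.ne_of_mem_erase ht (h ▸ rfl),
      hZ t (Finset.mem_of_mem_erase ht)⟩
  have first : ∀ (Z : Finset Y) (s : Y), s ∈ Z → f s ∈ W → (∀ t, f t ∈ W → t ∈ Z) →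
      depth s + W.card ≤ L →
      signedMinorSum A x (W.erase (f s)) * principalMinor (Matrix.scalar Y x - P) Z ≤
        signedMinorSum A x W * principalMinor (Matrix.scalar Y x - P) (Z.erase s) := by
    intro Z s hs hsW hZ hd
    have hcard := Finset.card_erase_add_one hsW
    have hα' := hα _ (Finset.erase_ssubset hsW)
    have hih := (ih _ (Finset.erase_ssubset hsW) fun W' hW' =>
      hα W' (hW'.trans (Finset.erase_ssubset hsW))).2
    rw [signedMinorSum_eq A x hsW fun i => h.diag i _, principalMinor_eq_add_sum _ hs]
    have hxx : (Matrix.scalar Y x - P) s s = x := by simp [h.diag']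
    rw [hxx]
    set D' := principalMinor (Matrix.scalar Y x - P) (Z.erase s)
    set α' := signedMinorSum A x (W.erase (f s))
    have hK := h.pathMinor_nonneg hpos s (Z.erase s)
    have h1 : (∑ j, ∑ u ∈ W.erase (f s), A j (f s) u *
        signedPathSum A x j (W.erase (f s)) u (f s)) * D' ≤ α' * ∑ t ∈ Z.erase s,
          P s t * pathMinor (Matrix.scalar Y x - P) (Z.erase s) t s := by
      calc _ = ∑ j, ∑ u ∈ W.erase (f s), A j (f s) u *
            (signedPathSum A x j (W.erase (f s)) u (f s) * D') := by
            simp only [Finset.sum_mul, mul_assoc]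
        _ ≤ ∑ j, ∑ t ∈ Z.erase s, (if key j s = key j t then A j (f s) (f t) else 0) *
            (α' * pathMinor (Matrix.scalar Y x - P) (Z.erase s) t s) := by
            refine Finset.sum_le_sum fun j _ => h.sum_mul_le (herase hZ) (by omega)
              (F := fun u => signedPathSum A x j (W.erase (f s)) u (f s) * D')
              (fun t ht => mul_nonneg hα' (hK t (Finset.notMem_erase s Z) ht)) ?_
            intro t ht hkey hdt
            exact hih _ s t j (Finset.notMem_erase s Z) (herase hZ t ht)
              (Finset.notMem_erase _ _) ht hkey (herase hZ) (by omega)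
        _ = ∑ t ∈ Z.erase s, (∑ j, if key j s = key j t then A j (f s) (f t) else 0) *
            (α' * pathMinor (Matrix.scalar Y x - P) (Z.erase s) t s) := by
            rw [Finset.sum_comm]; simp only [Finset.sum_mul]
        _ ≤ ∑ t ∈ Z.erase s, P s t *
            (α' * pathMinor (Matrix.scalar Y x - P) (Z.erase s) t s) :=
            Finset.sum_le_sum fun t ht => mul_le_mul_of_nonneg_right (h.sum_le s t)
              (mul_nonneg hα' (hK t (Finset.notMem_erase s Z) ht))
        _ = _ := by
            rw [Finset.mul_sum]; exact Finset.sum_congr rfl fun t _ => by ring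
    have h2 : ∑ t ∈ Z.erase s, (Matrix.scalar Y x - P) s t *
        pathMinor (Matrix.scalar Y x - P) (Z.erase s) t s =
        -∑ t ∈ Z.erase s, P s t * pathMinor (Matrix.scalar Y x - P) (Z.erase s) t s := by
      rw [← Finset.sum_neg_distrib]
      refine Finset.sum_congr rfl fun t ht => ?_
      rw [scalar_sub_apply_ne P x (Finset.ne_of_mem_erase ht).symm, neg_mul]
    rw [h2]
    linarith
  refine ⟨first, ?_⟩
  intro Z s t j hs ht hsW htW hkey hZ hd
  have hcard := Finset.card_erase_add_one htW
  have hα' := hα _ (Finset.erase_ssubset htW)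
  have hih := (ih _ (Finset.erase_ssubset htW) fun W' hW' =>
    hα W' (hW'.trans (Finset.erase_ssubset htW))).2
  have h1 := first Z t ht htW hZ hd
  have hKpos := h.pathMinor_nonneg hpos s Z t hs ht
  have hK := h.pathMinor_nonneg hpos s (Z.erase t)
  have hs' : s ∉ Z.erase t := fun h => hs (Finset.mem_of_mem_erase h)
  have hst : t ≠ s := fun h => hs (h ▸ ht)
  have h2 : signedPathSum A x j W (f t) (f s) * principalMinor (Matrix.scalar Y x - P) (Z.erase t) ≤
      signedMinorSum A x (W.erase (f t)) * pathMinor (Matrix.scalar Y x - P) Z t s := by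
    rw [signedPathSum_eq A x j htW hsW, pathMinor_eq _ ht hs, scalar_sub_apply_ne P x hst]
    have hsum : ∑ r ∈ Z.erase t, (Matrix.scalar Y x - P) t r *
        pathMinor (Matrix.scalar Y x - P) (Z.erase t) r s =
        -∑ r ∈ Z.erase t, P t r * pathMinor (Matrix.scalar Y x - P) (Z.erase t) r s := by
      rw [← Finset.sum_neg_distrib]
      refine Finset.sum_congr rfl fun r hr => ?_
      rw [scalar_sub_apply_ne P x (Finset.ne_of_mem_erase hr).symm, neg_mul]
    rw [hsum]
    set D' := principalMinor (Matrix.scalar Y x - P) (Z.erase t)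
    set α' := signedMinorSum A x (W.erase (f t))
    have h3 : (∑ u ∈ W.erase (f t), A j (f t) u *
        signedPathSum A x j (W.erase (f t)) u (f s)) * D' ≤ α' * ∑ r ∈ Z.erase t,
          P t r * pathMinor (Matrix.scalar Y x - P) (Z.erase t) r s := by
      calc _ = ∑ u ∈ W.erase (f t), A j (f t) u *
            (signedPathSum A x j (W.erase (f t)) u (f s) * D') := by
            simp only [Finset.sum_mul, mul_assoc]
        _ ≤ ∑ r ∈ Z.erase t, (if key j t = key j r then A j (f t) (f r) else 0) *
            (α' * pathMinor (Matrix.scalar Y x - P) (Z.erase t) r s) := by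
            refine h.sum_mul_le (herase hZ) (by omega)
              (F := fun u => signedPathSum A x j (W.erase (f t)) u (f s) * D')
              (fun r hr => mul_nonneg hα' (hK r hs' hr)) ?_
            intro r hr hkey' hdr
            exact hih _ s r j hs' (herase hZ r hr)
              (fun h => hsW (Finset.mem_of_mem_erase h)) hr (hkey.trans hkey') (herase hZ)
              (by omega)
        _ ≤ ∑ r ∈ Z.erase t, P t r *
            (α' * pathMinor (Matrix.scalar Y x - P) (Z.erase t) r s) :=
            Finset.sum_le_sum fun r hr => mul_le_mul_of_nonneg_right (h.ite_le t r j)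
              (mul_nonneg hα' (hK r hs' hr))
        _ = _ := by
            rw [Finset.mul_sum]; exact Finset.sum_congr rfl fun t _ => by ring
    have h4 : A j (f t) (f s) ≤ P t s := by
      have := h.ite_le t s j
      rwa [if_pos hkey.symm] at this
    have h5 := mul_le_mul_of_nonneg_right h4 (mul_nonneg hα' (hpos (Z.erase t)).le)
    change _ * (α' * D') ≤ _ * (α' * D') at h5
    linarith
  -- `h2` bounds the path sum through α(W \ f t), and `h1` trades this for α(W); the positive minor
  -- on Z \ t then cancels.
  refine le_of_mul_le_mul_right ?_ (hpos (Z.erase t))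
  have h6 := mul_le_mul_of_nonneg_right h2 (hpos Z).le
  have h7 := mul_le_mul_of_nonneg_right h1 hKpos
  linarith

/-- Positivity of the sum of a principal minor over all signings follows from positivity of the
principal minors of a graph that covers far enough around some vertex. -/
theorem signedMinorSum_pos (h : LiftsTo A P f key depth L) {x : ℝ}
    (hpos : ∀ Z, 0 < principalMinor (Matrix.scalar Y x - P) Z) (W : Finset V)
    (hα : ∀ W' ⊂ W, 0 < signedMinorSum A x W') (s : Y) (hs : f s ∈ W)
    (hd : depth s + W.card ≤ L) : 0 < signedMinorSum A x W := by
  have h1 := (h.comparison hpos W fun W' hW' => (hα W' hW').le).1 Finset.univ s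
    (Finset.mem_univ s) hs (fun t _ => Finset.mem_univ t) hd
  have h2 := mul_pos (hα _ (Finset.erase_ssubset hs)) (hpos Finset.univ)
  exact pos_of_mul_pos_left (h2.trans_le h1) (hpos _).le

end LiftsTo

end Comparison

end XRam

/-! ### Strings and lifts -/

namespace XRam

section Strings

variable {n c : ℕ} {A : Fin c → SimpleGraph (Fin n)} {v₁ : Fin n}

/-- The string indexing the copy of an atom of colour `j` that contains the vertex `s`. -/
def stringKey (j : Fin c) : List (Fin c × Fin n) → List (Fin c × Fin n)
  | [] => []
  | (C, v) :: s => if C = j then s else (C, v) :: s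

theorem stringKey_eq_self {j : Fin c} {s : List (Fin c × Fin n)} (h : ∀ p ∈ s.head?, p.1 ≠ j) :
    stringKey j s = s := by
  cases s with
  | nil => rfl
  | cons p s =>
    obtain ⟨C, v⟩ := p
    have : C ≠ j := h (C, v) (by simp)
    simp [stringKey, this]

theorem IsString.stringKey_spec {s : List (Fin c × Fin n)} (h : IsString A v₁ s) (j : Fin c) :
    IsString A v₁ (stringKey j s) ∧ (∀ p ∈ (stringKey j s).head?, p.1 ≠ j) ∧
      (stringKey j s = s ∨ ∃ v, s = (j, v) :: stringKey j s) := by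
  cases s with
  | nil => exact ⟨h, by simp [stringKey], Or.inl rfl⟩
  | cons p s =>
    obtain ⟨C, v⟩ := p
    by_cases hC : C = j
    · subst hC
      simp only [stringKey, if_true]
      exact ⟨h.1, h.2.1, Or.inr ⟨v, rfl⟩⟩
    · simp only [stringKey, hC, if_false]
      exact ⟨h, by simpa using hC, Or.inl trivial⟩

/-- A key drops the last step only for the colour of that step. So if i ≠ j, one of the two keys of
the longer string is that string itself, and a different string that is no longer cannot have it as
key. -/
theorem eq_of_stringKey_eq {i j : Fin c} {s t : List (Fin c × Fin n)} (hst : s ≠ t)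
    (hi : stringKey i s = stringKey i t) (hj : stringKey j s = stringKey j t) : i = j := by
  by_contra hij
  have hlen : ∀ (k : Fin c) (u : List (Fin c × Fin n)), (stringKey k u).length ≤ u.length := by
    intro k u
    rcases u with _ | ⟨⟨C, v⟩, u⟩
    · simp [stringKey]
    · simp only [stringKey]; split_ifs <;> simp
  have aux : ∀ s t : List (Fin c × Fin n), s ≠ t → stringKey i s = stringKey i t →
      stringKey j s = stringKey j t → t.length ≤ s.length → False := by
    intro s t hst hi hj hl
    rcases s with _ | ⟨⟨C, x⟩, k⟩
    · exact hst (List.length_eq_zero_iff.1 (Nat.le_zero.1 hl)).symm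
    · have hi' := congrArg List.length hi
      have hj' := congrArg List.length hj
      rcases t with _ | ⟨⟨D, y⟩, k'⟩
      · by_cases h1 : C = i
        · have h2 : C ≠ j := fun h => hij (h1.symm.trans h)
          simp [stringKey, h2] at hj'
        · simp [stringKey, h1] at hi'
      · simp only [stringKey] at hi hj hi' hj'
        by_cases h1 : C = i
        · have h2 : C ≠ j := fun h => hij (h1.symm.trans h)
          rw [if_neg h2] at hj hj'
          split_ifs at hj hj'
          · simp at hj' hl; omega
          · exact hst hj
        · rw [if_neg h1] at hi hi'
          split_ifs at hi hi'
          · simp at hi' hl; omega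
          · exact hst hi
  rcases le_total t.length s.length with h | h
  · exact aux s t hst hi hj h
  · exact aux t s hst.symm hi.symm hj.symm h

/-- The copy of an atom of colour j with key k consists of k and the strings k j v. The two edge
rules together give the edges of the atom on this copy. -/
theorem additiveProduct_adj_iff (s t : {s : List (Fin c × Fin n) // IsString A v₁ s}) :
    (additiveProduct A v₁).Adj s t ↔ ∃ j, stringKey j s.1 = stringKey j t.1 ∧
      (A j).Adj (endpoint v₁ s.1) (endpoint v₁ t.1) := by
  have key : ∀ s t : {s : List (Fin c × Fin n) // IsString A v₁ s}, EdgeRule A v₁ s.1 t.1 →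
      ∃ j, stringKey j s.1 = stringKey j t.1 ∧
      (A j).Adj (endpoint v₁ s.1) (endpoint v₁ t.1) := by
    rintro ⟨s, hs⟩ ⟨t, ht⟩ h
    cases h with
    | sibling k C x y h => exact ⟨C, by simp [stringKey], h⟩
    | child _ C y h =>
      refine ⟨C, ?_, h⟩
      simp only [stringKey, if_true]
      exact stringKey_eq_self ht.2.1
  constructor
  · rintro (h | h)
    · exact key s t h
    · obtain ⟨j, h1, h2⟩ := key t s h
      exact ⟨j, h1.symm, h2.symm⟩
  · rintro ⟨j, hk, hadj⟩
    obtain ⟨s, hs⟩ := s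
    obtain ⟨t, ht⟩ := t
    simp only at hk hadj
    obtain ⟨-, -, hs'⟩ := hs.stringKey_spec j
    obtain ⟨-, -, ht'⟩ := ht.stringKey_spec j
    rw [← hk] at ht'
    change EdgeRule A v₁ s t ∨ EdgeRule A v₁ t s
    generalize stringKey j s = k at hs' ht'
    rcases hs' with rfl | ⟨v, rfl⟩ <;> rcases ht' with rfl | ⟨w, rfl⟩
    · exact absurd rfl hadj.ne
    · exact Or.inl (.child _ _ _ hadj)
    · exact Or.inr (.child _ _ _ hadj.symm)
    · exact Or.inl (.sibling _ _ _ _ hadj)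

/-! ### Lifts of the sum graph and the map from strings onto them -/

variable {L : Type*}

/-- The copy of the atom of colour `j` that contains a vertex of the lift given by the
permutations `σ`. -/
def liftLabel (σ : Fin c → Fin n → Equiv.Perm L) (j : Fin c) (a : Fin n × L) : L := σ j a.1 a.2

/-- Edges of colour `j` in the lift given by the permutations `σ`. -/
def LiftAdj (A : Fin c → SimpleGraph (Fin n)) (σ : Fin c → Fin n → Equiv.Perm L) (j : Fin c)
    (a b : Fin n × L) : Prop :=
  (A j).Adj a.1 b.1 ∧ liftLabel σ j a = liftLabel σ j b

theorem LiftAdj.symm {σ : Fin c → Fin n → Equiv.Perm L} {j : Fin c} {a b : Fin n × L}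
    (h : LiftAdj A σ j a b) : LiftAdj A σ j b a :=
  ⟨h.1.symm, h.2.symm⟩

theorem eq_of_liftLabel_eq {σ : Fin c → Fin n → Equiv.Perm L} {j : Fin c} {a b : Fin n × L}
    (h1 : a.1 = b.1) (h2 : liftLabel σ j a = liftLabel σ j b) : a = b := by
  obtain ⟨a, k⟩ := a
  obtain ⟨b, l⟩ := b
  obtain rfl : a = b := h1
  simpa [liftLabel] using h2

/-- The map from strings to the vertices of a lift that follows the atoms. -/
def liftMap (v₁ : Fin n) (σ : Fin c → Fin n → Equiv.Perm L) (l₀ : L) :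
    List (Fin c × Fin n) → Fin n × L
  | [] => (v₁, l₀)
  | (C, v) :: s => (v, (σ C v).symm (liftLabel σ C (liftMap v₁ σ l₀ s)))

theorem liftMap_fst (σ : Fin c → Fin n → Equiv.Perm L) (l₀ : L) (s : List (Fin c × Fin n)) :
    (liftMap v₁ σ l₀ s).1 = endpoint v₁ s := by
  cases s <;> rfl

theorem liftLabel_liftMap (σ : Fin c → Fin n → Equiv.Perm L) (l₀ : L) (j : Fin c)
    (s : List (Fin c × Fin n)) :
    liftLabel σ j (liftMap v₁ σ l₀ s) = liftLabel σ j (liftMap v₁ σ l₀ (stringKey j s)) := by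
  rcases s with _ | ⟨⟨C, v⟩, s⟩
  · rfl
  · by_cases hC : C = j
    · subst hC; simp [stringKey, liftMap, liftLabel]
    · simp [stringKey, hC]

theorem liftAdj_liftMap {σ : Fin c → Fin n → Equiv.Perm L} {l₀ : L} {j : Fin c}
    {s t : List (Fin c × Fin n)} (hk : stringKey j s = stringKey j t)
    (h : (A j).Adj (endpoint v₁ s) (endpoint v₁ t)) :
    LiftAdj A σ j (liftMap v₁ σ l₀ s) (liftMap v₁ σ l₀ t) :=
  ⟨by simpa only [liftMap_fst] using h, by rw [liftLabel_liftMap, hk, ← liftLabel_liftMap]⟩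

/-- Path lifting: in the copy of the atom through s, either its root already ends at `b.1`, or
appending `b.1` to the root gives a legal string. The label of the copy fixes the remaining
coordinate. -/
theorem exists_liftMap_eq {σ : Fin c → Fin n → Equiv.Perm L} {l₀ : L} {j : Fin c}
    {s : List (Fin c × Fin n)} (hs : IsString A v₁ s) {b : Fin n × L}
    (h : LiftAdj A σ j (liftMap v₁ σ l₀ s) b) :
    ∃ t, IsString A v₁ t ∧ stringKey j s = stringKey j t ∧ liftMap v₁ σ l₀ t = b ∧
      t.length ≤ s.length + 1 := by
  obtain ⟨hk1, hk2, hk3⟩ := hs.stringKey_spec j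
  have hadj := h.1
  rw [liftMap_fst] at hadj
  have hlen : (stringKey j s).length ≤ s.length := by
    rcases hk3 with h | ⟨v, h⟩
    · rw [h]
    · rw [h]; simp [stringKey]
  have hsup : endpoint v₁ (stringKey j s) ∈ (A j).support := by
    rcases hk3 with h | ⟨v, h⟩
    · rw [h]; exact ⟨_, hadj⟩
    · rw [h] at hs; exact hs.2.2.1
  have hlab : liftLabel σ j (liftMap v₁ σ l₀ (stringKey j s)) = liftLabel σ j b := by
    rw [← liftLabel_liftMap]; exact h.2
  by_cases hu : endpoint v₁ (stringKey j s) = b.1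
  · refine ⟨stringKey j s, hk1, (stringKey_eq_self hk2).symm, ?_, by omega⟩
    exact eq_of_liftLabel_eq (by rw [liftMap_fst, hu]) hlab
  · refine ⟨(j, b.1) :: stringKey j s, ⟨hk1, hk2, hsup, ⟨_, hadj.symm⟩, hu⟩, by simp [stringKey], ?_,
      by simpa using hlen⟩
    refine eq_of_liftLabel_eq (σ := σ) (j := j) rfl ?_
    rw [liftLabel_liftMap]
    simpa [stringKey] using hlab

/-- The rule that consecutive vertices of a string differ prevents a child in the copy from
repeating the endpoint of the root of the copy. -/
theorem stringKey_endpoint_injective {j : Fin c} {s t : List (Fin c × Fin n)}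
    (hs : IsString A v₁ s) (ht : IsString A v₁ t) (hk : stringKey j s = stringKey j t)
    (he : endpoint v₁ s = endpoint v₁ t) : s = t := by
  obtain ⟨-, -, hs'⟩ := hs.stringKey_spec j
  obtain ⟨-, -, ht'⟩ := ht.stringKey_spec j
  rw [← hk] at ht'
  generalize stringKey j s = k at hs' ht'
  rcases hs' with rfl | ⟨v, rfl⟩ <;> rcases ht' with rfl | ⟨w, rfl⟩
  · rfl
  · exact absurd he ht.2.2.2.2
  · exact absurd he.symm hs.2.2.2.2
  · simpa [endpoint] using he

end Strings

/-! ### Adjacency matrices of lifts and of balls in the additive product -/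

section LiftMatrix

variable {n c : ℕ} (A : Fin c → SimpleGraph (Fin n)) {L : Type*}

open Classical in
/-- The adjacency matrix of colour `j` of a lift. -/
noncomputable def liftMatrix (σ : Fin c → Fin n → Equiv.Perm L) (j : Fin c) :
    Matrix (Fin n × L) (Fin n × L) ℝ :=
  Matrix.of fun a b => if LiftAdj A σ j a b then 1 else 0

theorem liftMatrix_isSymm (σ : Fin c → Fin n → Equiv.Perm L) (j : Fin c) :
    (liftMatrix A σ j).IsSymm := by
  ext a b
  simp only [liftMatrix, Matrix.transpose_apply, Matrix.of_apply]
  congr 1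
  exact propext ⟨LiftAdj.symm, LiftAdj.symm⟩

/-- Strings of length at most `N`. -/
abbrev StringBall (v₁ : Fin n) (N : ℕ) : Type :=
  {s : {s : List (Fin c × Fin n) // IsString A v₁ s} // s.1.length ≤ N}

instance (v₁ : Fin n) (N : ℕ) : Finite (StringBall A v₁ N) := by
  have : Finite {s : List (Fin c × Fin n) // s.length ≤ N} := List.finite_length_le _ N
  exact Finite.of_injective (β := {s : List (Fin c × Fin n) // s.length ≤ N})
    (fun s => ⟨s.1.1, s.2⟩) fun s t h => by
      have h' := congrArg Subtype.val h
      exact Subtype.ext (Subtype.ext h')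

open Classical in
/-- The adjacency matrix of the additive product on a finite set of strings. -/
noncomputable def ballMatrix (v₁ : Fin n) (N : ℕ) :
    Matrix (StringBall A v₁ N) (StringBall A v₁ N) ℝ :=
  Matrix.of fun s t => if (additiveProduct A v₁).Adj s.1 t.1 then 1 else 0

/-- In `sum_le` at most one colour contributes, because distinct strings lie in a common copy for at
most one colour. The field `lift` is path lifting, cut off at the radius of the ball. -/
theorem liftsTo_ballMatrix (v₁ : Fin n) (σ : Fin c → Fin n → Equiv.Perm L) (l₀ : L) (N : ℕ) :
    LiftsTo (liftMatrix A σ) (ballMatrix A v₁ N) (fun s => liftMap v₁ σ l₀ s.1.1)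
      (fun j s => stringKey j s.1.1) (fun s => s.1.1.length) N where
  nonneg j a b := by simp only [liftMatrix, Matrix.of_apply]; split_ifs <;> norm_num
  diag j a := by simp [liftMatrix, LiftAdj]
  diag' s := by simp [ballMatrix]
  sum_le s t := by
    have hterm : ∀ j, (if stringKey j s.1.1 = stringKey j t.1.1 then
        liftMatrix A σ j (liftMap v₁ σ l₀ s.1.1) (liftMap v₁ σ l₀ t.1.1) else 0) ≠ 0 →
        stringKey j s.1.1 = stringKey j t.1.1 ∧
          (A j).Adj (endpoint v₁ s.1.1) (endpoint v₁ t.1.1) := by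
      intro j h
      simp only [liftMatrix, Matrix.of_apply] at h
      split_ifs at h with h1 h2
      · exact ⟨h1, by simpa only [liftMap_fst] using h2.1⟩
      all_goals simp at h
    by_cases hadj : (additiveProduct A v₁).Adj s.1 t.1
    · obtain ⟨j, hj, hj'⟩ := (additiveProduct_adj_iff s.1 t.1).1 hadj
      rw [Finset.sum_eq_single j]
      · simp only [ballMatrix, liftMatrix, Matrix.of_apply, if_pos hadj]
        split_ifs <;> norm_num
      · intro i _ hij
        by_contra h0
        exact hij (eq_of_stringKey_eq (fun h => hadj.ne (Subtype.ext h)) (hterm i h0).1 hj)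
      · simp
    · rw [Finset.sum_eq_zero]
      · simp [ballMatrix, hadj]
      · intro j _
        by_contra h0
        exact hadj ((additiveProduct_adj_iff s.1 t.1).2 ⟨j, hterm j h0⟩)
  lift s j b hs h := by
    have h' : LiftAdj A σ j (liftMap v₁ σ l₀ s.1.1) b := by
      by_contra h0
      exact h (by simp [liftMatrix, h0])
    obtain ⟨t, ht, h1, h2, h3⟩ := exists_liftMap_eq s.1.2 h'
    exact ⟨⟨⟨t, ht⟩, by simp only; omega⟩, h1, h2, h3⟩

end LiftMatrix

end XRam

/-! ### Counting walks -/

namespace XRam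

section WalkCount

universe u v

variable {α : Type u} {β : Type v}

/-- The edges at `x` together with their other end. -/
abbrev Links (G : Graph α β) (x : α) : Type (max u v) := {p : β × α // G.IsLink p.1 x p.2}

/-- A walk of positive length is a first step followed by a walk. -/
def walkSuccEquiv (G : Graph α β) (t : ℕ) (x z : α) :
    Walk G (t + 1) x z ≃ Σ p : Links G x, Walk G t p.1.2 z where
  toFun
    | .cons e h p => ⟨⟨(e, _), h⟩, p⟩
  invFun q := .cons q.1.1.1 q.1.2 q.2
  left_inv := by rintro ⟨⟩; rfl
  right_inv := by rintro ⟨⟨⟨e, y⟩, h⟩, p⟩; rfl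

theorem walk_zero_subsingleton (G : Graph α β) (x y : α) : Subsingleton (Walk G 0 x y) :=
  ⟨by rintro ⟨⟩ ⟨⟩; rfl⟩

theorem walkCount_zero_self {G : Graph α β} {x : α} (hx : x ∈ V(G)) : walkCount G 0 x x = 1 := by
  have := walk_zero_subsingleton G x x
  have : Nonempty (Walk G 0 x x) := ⟨.nil hx⟩
  exact Nat.card_of_subsingleton (Walk.nil hx)

variable {n c : ℕ} (A : Fin c → SimpleGraph (Fin n))

open Classical in
/-- The adjacency matrix of the sum graph. -/
noncomputable def sumMatrix : Matrix (Fin n) (Fin n) ℝ :=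
  Matrix.of fun a b => ∑ j, if (A j).Adj a b then 1 else 0

theorem sumMatrix_nonneg (a b : Fin n) : 0 ≤ sumMatrix A a b := by
  rw [sumMatrix, Matrix.of_apply]
  exact Finset.sum_nonneg fun j _ => by split_ifs <;> norm_num

/-- The number of walks of length `t` from `v` in the sum graph. -/
noncomputable def sumWalks (t : ℕ) : Fin n → ℝ := (sumMatrix A ^ t).mulVec 1

theorem sumWalks_zero (a : Fin n) : sumWalks A 0 a = 1 := by simp [sumWalks]

theorem sumWalks_succ (t : ℕ) (a : Fin n) :
    sumWalks A (t + 1) a = ∑ b, sumMatrix A a b * sumWalks A t b := by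
  rw [sumWalks, pow_succ', ← Matrix.mulVec_mulVec]
  rfl

theorem sumWalks_nonneg (t : ℕ) (a : Fin n) : 0 ≤ sumWalks A t a := by
  induction t generalizing a with
  | zero => simp [sumWalks_zero]
  | succ t ih =>
    rw [sumWalks_succ]
    exact Finset.sum_nonneg fun b _ => mul_nonneg (sumMatrix_nonneg A a b) (ih b)

theorem exists_sumWalks_le : ∃ K : ℝ, 1 ≤ K ∧ ∀ t a, sumWalks A t a ≤ K ^ t := by
  refine ⟨1 + ∑ a, ∑ b, sumMatrix A a b, ?_, fun t => ?_⟩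
  · linarith [Finset.sum_nonneg fun a (_ : a ∈ Finset.univ) =>
      Finset.sum_nonneg fun b (_ : b ∈ Finset.univ) => sumMatrix_nonneg A a b]
  · induction t with
    | zero => simp [sumWalks_zero]
    | succ t ih =>
      intro a
      set K := 1 + ∑ a, ∑ b, sumMatrix A a b with hK
      have h1 : ∑ b, sumMatrix A a b ≤ K := by
        have := Finset.single_le_sum (f := fun a => ∑ b, sumMatrix A a b) (fun a _ =>
          Finset.sum_nonneg fun b _ => sumMatrix_nonneg A a b) (Finset.mem_univ a)
        change ∑ b, sumMatrix A a b ≤ ∑ a, ∑ b, sumMatrix A a b at this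
        linarith
      have hK0 : 0 ≤ K := (Finset.sum_nonneg fun b _ => sumMatrix_nonneg A a b).trans h1
      calc sumWalks A (t + 1) a = ∑ b, sumMatrix A a b * sumWalks A t b := sumWalks_succ A t a
        _ ≤ ∑ b, sumMatrix A a b * K ^ t := Finset.sum_le_sum fun b _ =>
            mul_le_mul_of_nonneg_left (ih b) (sumMatrix_nonneg A a b)
        _ = (∑ b, sumMatrix A a b) * K ^ t := by rw [Finset.sum_mul]
        _ ≤ K * K ^ t := mul_le_mul_of_nonneg_right h1 (pow_nonneg hK0 t)
        _ = K ^ (t + 1) := by ring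

/-- The relation `R` maps vertices of `G` to vertices of the sum graph so that the edges at a vertex
inject into the edges at its images. -/
def LinksInject (G : Graph α β) (R : α → Fin n → Prop) : Prop :=
  ∀ x a, R x a → ∃ g : Links G x → Fin c × Fin n, Function.Injective g ∧
    ∀ p, (A (g p).1).Adj a (g p).2 ∧ R p.1.2 (g p).2

variable {A}

/-- Finiteness is carried through the induction because `Nat.card` of an infinite type is 0 and
would count nothing. -/
theorem LinksInject.walkCount_le {G : Graph α β} {R : α → Fin n → Prop} (h : LinksInject A G R)
    (t : ℕ) : ∀ x a y, R x a →
      Finite (Walk G t x y) ∧ (walkCount G t x y : ℝ) ≤ sumWalks A t a := by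
  classical
  induction t with
  | zero =>
    intro x a y _
    have := walk_zero_subsingleton G x y
    refine ⟨inferInstance, ?_⟩
    rw [sumWalks_zero]
    exact_mod_cast Finite.card_le_one_iff_subsingleton.2 this
  | succ t ih =>
    intro x a y hx
    obtain ⟨g, hg, hgR⟩ := h x a hx
    have hfin : Finite (Links G x) := Finite.of_injective g hg
    have hft : Fintype (Links G x) := Fintype.ofFinite _
    have hw : ∀ p : Links G x, Finite (Walk G t p.1.2 y) := fun p => (ih _ _ y (hgR p).2).1
    refine ⟨Finite.of_equiv _ (walkSuccEquiv G t x y).symm, ?_⟩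
    rw [walkCount, Nat.card_congr (walkSuccEquiv G t x y), Nat.card_sigma, Nat.cast_sum,
      sumWalks_succ]
    set F : Fin c × Fin n → ℝ := fun q => if (A q.1).Adj a q.2 then sumWalks A t q.2 else 0 with hF
    have hF0 : ∀ q, 0 ≤ F q := fun q => by
      simp only [hF]; split_ifs
      exacts [sumWalks_nonneg A t _, le_rfl]
    calc ∑ p : Links G x, (walkCount G t p.1.2 y : ℝ) ≤ ∑ p : Links G x, F (g p) := by
          refine Finset.sum_le_sum fun p _ => ?_
          simp only [hF, if_pos (hgR p).1]
          exact (ih _ _ y (hgR p).2).2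
      _ = ∑ q ∈ Finset.univ.image g, F q := (Finset.sum_image hg.injOn).symm
      _ ≤ ∑ q, F q := Finset.sum_le_sum_of_subset_of_nonneg (Finset.subset_univ _) fun q _ _ => hF0 q
      _ = ∑ b, sumMatrix A a b * sumWalks A t b := by
          rw [Fintype.sum_prod_type_right]
          refine Finset.sum_congr rfl fun b _ => ?_
          simp only [sumMatrix, Matrix.of_apply, Finset.sum_mul, hF, ite_mul, one_mul, zero_mul]

/-- A quotient of X comes without a map to the sum graph, so a relation is used instead: x is
related to the endpoints of its preimages. Edges at x lift to edges at any chosen preimage. -/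
theorem LinksInject.of_isCovering {α' : Type*} {β' : Type*} {X : Graph α β} {G : Graph α' β'}
    {fV : V(X) → V(G)} {fE : E(X) → E(G)} (hcov : IsCovering X G fV fE) {R : α → Fin n → Prop}
    (h : LinksInject A X R) :
    LinksInject A G fun x a => ∃ s : V(X), (fV s).1 = x ∧ R s.1 a := by
  rintro x a ⟨s, rfl, hs⟩
  obtain ⟨g, hg, hgR⟩ := h s.1 a hs
  have hl : ∀ p : Links G (fV s).1, ∃ (e : E(X)) (y : V(X)), X.IsLink e s y ∧
      (fE e).1 = p.1.1 ∧ (fV y).1 = p.1.2 := by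
    intro p
    obtain ⟨e, he, hep⟩ := (hcov.bijOn_incident s).surjOn
      (show (⟨p.1.1, p.2.edge_mem⟩ : E(G)) ∈ {e : E(G) | G.Inc e (fV s)} from ⟨_, p.2⟩)
    obtain ⟨y, hy⟩ := he
    refine ⟨e, ⟨y, hy.right_mem⟩, hy, congrArg Subtype.val hep, ?_⟩
    have h1 := hcov.map_isLink e s ⟨y, hy.right_mem⟩ hy
    rw [hep] at h1
    exact h1.right_unique p.2
  choose e y hl he hy using hl
  refine ⟨fun p => g ⟨((e p).1, (y p).1), hl p⟩, fun p q hpq => ?_, fun p => ?_⟩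
  · have h1 := congrArg Subtype.val (hg hpq)
    simp only [Prod.mk.injEq] at h1
    have h2 : e p = e q := Subtype.ext h1.1
    have h3 : y p = y q := Subtype.ext h1.2
    exact Subtype.ext (Prod.ext (by rw [← he p, ← he q, h2]) (by rw [← hy p, ← hy q, h3]))
  · have := hgR ⟨((e p).1, (y p).1), hl p⟩
    exact ⟨this.1, y p, hy p, this.2⟩

theorem linksInject_additiveProduct (v₁ : Fin n) :
    LinksInject A (Graph.ofSimpleGraph (additiveProduct A v₁)) fun s a => endpoint v₁ s.1 = a := by
  rintro s _ rfl
  have h : ∀ p : Links (Graph.ofSimpleGraph (additiveProduct A v₁)) s,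
      ∃ j, stringKey j s.1 = stringKey j p.1.2.1 ∧
        (A j).Adj (endpoint v₁ s.1) (endpoint v₁ p.1.2.1) := by
    intro p
    obtain ⟨h1, h2⟩ := p.2
    rw [h1] at h2
    exact (additiveProduct_adj_iff s p.1.2).1 h2
  choose j hk hadj using h
  refine ⟨fun p => (j p, endpoint v₁ p.1.2.1), fun p q hpq => ?_, fun p => ⟨hadj p, rfl⟩⟩
  simp only [Prod.mk.injEq] at hpq
  have h1 := hk q
  rw [← hpq.1, hk p] at h1
  have h2 : p.1.2 = q.1.2 :=
    Subtype.ext (stringKey_endpoint_injective p.1.2.2 q.1.2.2 h1 hpq.2)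
  refine Subtype.ext (Prod.ext ?_ h2)
  rw [p.2.1, q.2.1, h2]

theorem LinksInject.isBoundedUnder {G : Graph α β} {R : α → Fin n → Prop} (h : LinksInject A G R) :
    ∃ K : ℝ, ∀ x a y, R x a → ∀ t : ℕ, (walkCount G t x y : ℝ) ^ (1 / (t : ℝ)) ≤ K := by
  obtain ⟨K, hK1, hK⟩ := exists_sumWalks_le A
  refine ⟨K, fun x a y hx t => ?_⟩
  have hle := ((h.walkCount_le t x a y hx).2).trans (hK t a)
  rcases Nat.eq_zero_or_pos t with rfl | ht
  -- At t = 0 the exponent 1 / 0 is 0 and the power is 1, which is why K ≥ 1 is required.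
  · simpa using hK1
  · calc (walkCount G t x y : ℝ) ^ (1 / (t : ℝ)) ≤ (K ^ t) ^ (1 / (t : ℝ)) :=
          Real.rpow_le_rpow (Nat.cast_nonneg _) hle (by positivity)
      _ = K := by
          rw [one_div]; exact Real.pow_rpow_inv_natCast (by linarith) ht.ne'

theorem limsup_walkCount_nonneg {G : Graph α β} {x y : α} {K : ℝ}
    (h : ∀ t : ℕ, (walkCount G t x y : ℝ) ^ (1 / (t : ℝ)) ≤ K) :
    0 ≤ limsup (fun t : ℕ => (walkCount G t x y : ℝ) ^ (1 / (t : ℝ))) atTop :=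
  le_limsup_of_frequently_le (Frequently.of_forall fun _ => Real.rpow_nonneg (Nat.cast_nonneg _) _)
    (isBoundedUnder_of ⟨K, h⟩)

theorem LinksInject.specRadius_nonneg {G : Graph α β} {R : α → Fin n → Prop}
    (h : LinksInject A G R) (hR : ∀ x ∈ V(G), ∃ a, R x a) : 0 ≤ specRadius G := by
  obtain ⟨K, hK⟩ := h.isBoundedUnder
  refine Real.iSup_nonneg fun p => ?_
  obtain ⟨a, ha⟩ := hR p.1.1 p.1.2
  exact limsup_walkCount_nonneg (hK _ _ _ ha)

theorem LinksInject.eventually_walkCount_le {G : Graph α β} {R : α → Fin n → Prop}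
    (h : LinksInject A G R) (hR : ∀ x ∈ V(G), ∃ a, R x a) {r : ℝ} (hr : specRadius G < r)
    {x y : α} (hx : x ∈ V(G)) (hy : y ∈ V(G)) :
    ∀ᶠ t : ℕ in atTop, (walkCount G t x y : ℝ) ≤ r ^ t := by
  obtain ⟨K, hK⟩ := h.isBoundedUnder
  have hb : ∀ p : V(G) × V(G), ∀ t : ℕ, (walkCount G t p.1 p.2 : ℝ) ^ (1 / (t : ℝ)) ≤ K := by
    intro p
    obtain ⟨a, ha⟩ := hR p.1.1 p.1.2
    exact hK _ _ _ ha
  -- Without boundedness the supremum defining the spectral radius would take the default value 0.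
  have hbdd : BddAbove (Set.range fun p : V(G) × V(G) =>
      limsup (fun t : ℕ => (walkCount G t p.1 p.2 : ℝ) ^ (1 / (t : ℝ))) atTop) := by
    refine ⟨K, ?_⟩
    rintro _ ⟨p, rfl⟩
    exact limsup_le_of_le (isCoboundedUnder_le_of_le atTop (x := 0) fun t =>
      Real.rpow_nonneg (Nat.cast_nonneg _) _) (Eventually.of_forall (hb p))
  have hlt := (le_ciSup hbdd (⟨x, hx⟩, ⟨y, hy⟩)).trans_lt hr
  have hev := eventually_lt_of_limsup_lt hlt (isBoundedUnder_of ⟨K, hb _⟩)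
  filter_upwards [hev, eventually_gt_atTop 0] with t ht ht0
  have h0 : (0 : ℝ) ≤ walkCount G t x y := Nat.cast_nonneg _
  calc (walkCount G t x y : ℝ) = ((walkCount G t x y : ℝ) ^ (1 / (t : ℝ))) ^ t := by
        rw [one_div, Real.rpow_inv_natCast_pow h0 ht0.ne']
    _ ≤ r ^ t := pow_le_pow_left₀ (Real.rpow_nonneg h0 _) ht.le t

theorem LinksInject.specRadius_le {G : Graph α β} {R : α → Fin n → Prop}
    (h : LinksInject A G R) (hR : ∀ x ∈ V(G), ∃ a, R x a) (hne : V(G).Nonempty) {C r : ℝ}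
    (hr : 0 ≤ r) (hC : ∀ t a, sumWalks A t a ≤ C * r ^ t) : specRadius G ≤ r := by
  have : Nonempty (V(G) × V(G)) := ⟨⟨_, hne.some_mem⟩, ⟨_, hne.some_mem⟩⟩
  refine ciSup_le fun p => le_of_forall_gt_imp_ge_of_dense fun q hq => ?_
  obtain ⟨a, ha⟩ := hR p.1.1 p.1.2
  refine limsup_le_of_le (isCoboundedUnder_le_of_le atTop (x := 0) fun t =>
      Real.rpow_nonneg (Nat.cast_nonneg _) _) ?_
  have hq0 : 0 < q := hr.trans_lt hq
  have hlim : Tendsto (fun t : ℕ => C * (r / q) ^ t) atTop (nhds (C * 0)) :=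
    (tendsto_pow_atTop_nhds_zero_of_lt_one (div_nonneg hr hq0.le)
      ((div_lt_one hq0).2 hq)).const_mul C
  rw [mul_zero] at hlim
  filter_upwards [hlim.eventually (gt_mem_nhds one_pos), eventually_gt_atTop 0] with t ht ht0
  have h1 : (walkCount G t p.1 p.2 : ℝ) ≤ q ^ t := by
    refine ((h.walkCount_le t _ a p.2 ha).2.trans (hC t a)).trans ?_
    rw [div_pow, ← mul_div_assoc, div_lt_one (pow_pos hq0 t)] at ht
    exact ht.le
  calc (walkCount G t p.1 p.2 : ℝ) ^ (1 / (t : ℝ)) ≤ (q ^ t) ^ (1 / (t : ℝ)) :=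
        Real.rpow_le_rpow (Nat.cast_nonneg _) h1 (by positivity)
    _ = q := by rw [one_div]; exact Real.pow_rpow_inv_natCast hq0.le ht0.ne'

end WalkCount

end XRam

/-! ### Spectral bounds for symmetric matrices -/

namespace XRam

set_option linter.unusedSectionVars false

section Spectral

open Matrix

variable {ι : Type*} [Fintype ι] [DecidableEq ι]

/-- The quadratic form of `M` is at most `r` times the square of the norm. -/
def QuadFormLE (M : Matrix ι ι ℝ) (r : ℝ) : Prop := ∀ x : ι → ℝ, x ⬝ᵥ M *ᵥ x ≤ r * (x ⬝ᵥ x)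

/-- The coordinates of the `i`-th vector of an orthonormal basis of eigenvectors. -/
noncomputable def eigenvec {M : Matrix ι ι ℝ} (hM : M.IsHermitian) (i : ι) : ι → ℝ :=
  ⇑(hM.eigenvectorBasis i)

variable {M : Matrix ι ι ℝ} (hM : M.IsHermitian)

theorem mulVec_eigenvec (i : ι) : M *ᵥ eigenvec hM i = hM.eigenvalues i • eigenvec hM i :=
  hM.mulVec_eigenvectorBasis i

theorem eigenvec_dotProduct (i j : ι) :
    eigenvec hM i ⬝ᵥ eigenvec hM j = if i = j then 1 else 0 := by
  have := orthonormal_iff_ite.1 hM.eigenvectorBasis.orthonormal j i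
  rw [EuclideanSpace.inner_eq_star_dotProduct] at this
  simpa [eigenvec, eq_comm] using this

theorem sum_eigenvec (x : ι → ℝ) : ∑ i, (eigenvec hM i ⬝ᵥ x) • eigenvec hM i = x := by
  have := congrArg (fun y : EuclideanSpace ℝ ι => (y : ι → ℝ))
    (hM.eigenvectorBasis.sum_repr' (WithLp.toLp 2 x))
  simp only [EuclideanSpace.inner_eq_star_dotProduct] at this
  conv_rhs => rw [show x = (WithLp.toLp 2 x : EuclideanSpace ℝ ι).ofLp from rfl, ← this]
  ext k
  simp [eigenvec, dotProduct_comm]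

theorem dotProduct_eq_sum_sq (x : ι → ℝ) : x ⬝ᵥ x = ∑ i, (eigenvec hM i ⬝ᵥ x) ^ 2 := by
  conv_lhs => enter [2]; rw [← sum_eigenvec hM x]
  rw [dotProduct_sum]
  refine Finset.sum_congr rfl fun i _ => ?_
  rw [dotProduct_smul, dotProduct_comm, smul_eq_mul, sq]

theorem dotProduct_mulVec_eq_sum (x : ι → ℝ) :
    x ⬝ᵥ M *ᵥ x = ∑ i, hM.eigenvalues i * (eigenvec hM i ⬝ᵥ x) ^ 2 := by
  conv_lhs => enter [2, 2]; rw [← sum_eigenvec hM x]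
  rw [mulVec_sum, dotProduct_sum]
  refine Finset.sum_congr rfl fun i _ => ?_
  rw [mulVec_smul, mulVec_eigenvec, dotProduct_smul, dotProduct_smul, dotProduct_comm, smul_eq_mul,
    smul_eq_mul]
  ring

theorem quadFormLE_of_eigenvalues_le {r : ℝ} (h : ∀ i, hM.eigenvalues i ≤ r) : QuadFormLE M r := by
  intro x
  rw [dotProduct_mulVec_eq_sum hM, dotProduct_eq_sum_sq hM, Finset.mul_sum]
  exact Finset.sum_le_sum fun i _ => mul_le_mul_of_nonneg_right (h i) (sq_nonneg _)

theorem eval_charpoly_eigenvalues (i : ι) : M.charpoly.eval (hM.eigenvalues i) = 0 := by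
  rw [hM.charpoly_eq, Polynomial.eval_prod]
  exact Finset.prod_eq_zero (Finset.mem_univ i) (by simp)

theorem QuadFormLE.principalMinor_pos {M : Matrix ι ι ℝ} (hM : M.IsHermitian) {r x : ℝ}
    (h : QuadFormLE M r) (hx : r < x) (Z : Finset ι) :
    0 < principalMinor (Matrix.scalar ι x - M) Z := by
  rw [principalMinor_eq_det_submatrix]
  refine Matrix.PosDef.det_pos (Matrix.PosDef.submatrix ?_ Subtype.val_injective)
  refine Matrix.PosDef.of_dotProduct_mulVec_pos ?_ ?_
  · refine Matrix.IsHermitian.sub ?_ hM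
    simp [Matrix.IsHermitian]
  · intro y hy
    have h0 : 0 < y ⬝ᵥ y := by
      have := Matrix.dotProduct_star_self_pos_iff.2 hy
      simpa using this
    have h1 := h y
    rw [Matrix.sub_mulVec, dotProduct_sub]
    simp only [star_trivial, Matrix.scalar_apply]
    rw [show (Matrix.diagonal fun _ : ι => x) *ᵥ y = x • y by
      ext i; simp [Matrix.mulVec_diagonal], dotProduct_smul, smul_eq_mul]
    nlinarith

/-- Perron's argument: for nonnegative M, passing from an eigenvector e to |e| keeps the norm and
makes the form at least the absolute value of the eigenvalue. -/
theorem abs_eigenvalues_le (hnn : ∀ i j, 0 ≤ M i j) {r : ℝ} (h : QuadFormLE M r) (i : ι) :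
    |hM.eigenvalues i| ≤ r := by
  set e := eigenvec hM i with he
  have h1 : e ⬝ᵥ e = 1 := by rw [he, eigenvec_dotProduct, if_pos rfl]
  have h2 : e ⬝ᵥ M *ᵥ e = hM.eigenvalues i := by
    rw [he, mulVec_eigenvec, dotProduct_smul, ← he, h1, smul_eq_mul, mul_one]
  have h3 := h fun k => |e k|
  have h4 : (fun k => |e k|) ⬝ᵥ (fun k => |e k|) = 1 := by
    rw [← h1]; simp [dotProduct]
  rw [h4, mul_one] at h3
  rw [← h2]
  refine le_trans ?_ h3
  simp only [dotProduct, mulVec]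
  refine (Finset.abs_sum_le_sum_abs _ _).trans (Finset.sum_le_sum fun k _ => ?_)
  rw [abs_mul]
  refine mul_le_mul_of_nonneg_left ?_ (abs_nonneg _)
  refine (Finset.abs_sum_le_sum_abs _ _).trans (Finset.sum_le_sum fun l _ => ?_)
  rw [abs_mul, abs_of_nonneg (hnn k l)]

theorem pow_mulVec_eigenvec (i : ι) (t : ℕ) :
    (M ^ t) *ᵥ eigenvec hM i = hM.eigenvalues i ^ t • eigenvec hM i := by
  induction t with
  | zero => simp
  | succ t ih =>
    rw [pow_succ, ← mulVec_mulVec, mulVec_eigenvec, mulVec_smul, ih, smul_smul, pow_succ, mul_comm]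

theorem exists_pow_mulVec_le {r : ℝ} (h : ∀ i, |hM.eigenvalues i| ≤ r) (x : ι → ℝ) :
    ∃ C, ∀ t k, ((M ^ t) *ᵥ x) k ≤ C * r ^ t := by
  refine ⟨∑ k, ∑ i, |(eigenvec hM i ⬝ᵥ x) * eigenvec hM i k|, fun t k => ?_⟩
  have h1 : ((M ^ t) *ᵥ x) k =
      ∑ i, hM.eigenvalues i ^ t * ((eigenvec hM i ⬝ᵥ x) * eigenvec hM i k) := by
    conv_lhs => rw [← sum_eigenvec hM x]
    rw [mulVec_sum, Finset.sum_apply]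
    refine Finset.sum_congr rfl fun i _ => ?_
    rw [mulVec_smul, pow_mulVec_eigenvec]
    simp only [Pi.smul_apply, smul_eq_mul]
    ring
  have hr : ∀ i, hM.eigenvalues i ^ t ≤ r ^ t ∧ 0 ≤ r ^ t := fun i => by
    have := pow_le_pow_left₀ (abs_nonneg _) (h i) t
    rw [← abs_pow] at this
    exact ⟨(le_abs_self _).trans this, (abs_nonneg _).trans this⟩
  rw [h1]
  calc _ ≤ ∑ i, |(eigenvec hM i ⬝ᵥ x) * eigenvec hM i k| * r ^ t := by
        refine Finset.sum_le_sum fun i _ => ?_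
        refine (le_abs_self _).trans ?_
        rw [abs_mul, mul_comm, abs_pow]
        exact mul_le_mul_of_nonneg_left (pow_le_pow_left₀ (abs_nonneg _) (h i) t) (abs_nonneg _)
    _ = (∑ i, |(eigenvec hM i ⬝ᵥ x) * eigenvec hM i k|) * r ^ t := by rw [Finset.sum_mul]
    _ ≤ _ := by
        refine mul_le_mul_of_nonneg_right ?_ (hr k).2
        exact Finset.single_le_sum (f := fun k => ∑ i, |(eigenvec hM i ⬝ᵥ x) * eigenvec hM i k|)
          (fun k _ => Finset.sum_nonneg fun i _ => abs_nonneg _) (Finset.mem_univ k)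

/-- If the entries of the powers of `M` grow at most like `r ^ t`, then so do the eigenvalues. -/
theorem eigenvalues_le_of_eventually {r : ℝ} (hr : 0 < r)
    (h : ∀ k l, ∀ᶠ t : ℕ in atTop, 0 ≤ (M ^ t) k l ∧ (M ^ t) k l ≤ r ^ t) (i : ι) :
    hM.eigenvalues i ≤ r := by
  by_contra hcon
  push Not at hcon
  set e := eigenvec hM i with he
  have hne : ∃ k, e k ≠ 0 := by
    by_contra h0
    push Not at h0
    have h1 : e ⬝ᵥ e = 1 := by rw [he, eigenvec_dotProduct, if_pos rfl]
    rw [show e = 0 from funext h0] at h1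
    simp at h1
  obtain ⟨k, hk⟩ := hne
  have hev : ∀ᶠ t : ℕ in atTop, (hM.eigenvalues i / r) ^ t * |e k| ≤ ∑ l, |e l| := by
    have h' : ∀ᶠ t : ℕ in atTop, ∀ l, 0 ≤ (M ^ t) k l ∧ (M ^ t) k l ≤ r ^ t :=
      eventually_all.2 fun l => h k l
    filter_upwards [h'] with t ht
    have h1 := congrFun (pow_mulVec_eigenvec hM i t) k
    simp only [Pi.smul_apply, smul_eq_mul, ← he] at h1
    rw [div_pow, div_mul_eq_mul_div, div_le_iff₀ (pow_pos hr t)]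
    calc hM.eigenvalues i ^ t * |e k| = |((M ^ t) *ᵥ e) k| := by
          rw [h1, abs_mul, abs_of_nonneg (pow_nonneg (hr.le.trans hcon.le) t)]
      _ ≤ ∑ l, |(M ^ t) k l * e l| := Finset.abs_sum_le_sum_abs _ _
      _ ≤ ∑ l, |e l| * r ^ t := Finset.sum_le_sum fun l _ => by
          rw [abs_mul, abs_of_nonneg (ht l).1, mul_comm]
          exact mul_le_mul_of_nonneg_left (ht l).2 (abs_nonneg _)
      _ = _ := by rw [Finset.sum_mul]
  have hlim : Tendsto (fun t : ℕ => (hM.eigenvalues i / r) ^ t * |e k|) atTop atTop :=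
    (tendsto_pow_atTop_atTop_of_one_lt ((one_lt_div hr).2 hcon)).atTop_mul_const (abs_pos.2 hk)
  obtain ⟨t, h1, h2⟩ := (hev.and (hlim.eventually (eventually_gt_atTop _))).exists
  exact absurd h1 (not_le.2 h2)

/-- If the quadratic form of `M` is at most `r` on the kernel of `k` linear functionals, then the
`(k + 1)`-st eigenvalue is at most `r`. -/
theorem eigenvalues₀_le_of_ker {k : ℕ} (hk : k < Fintype.card ι) {r : ℝ}
    (T : (ι → ℝ) →ₗ[ℝ] (Fin k → ℝ)) (h : ∀ x, T x = 0 → x ⬝ᵥ M *ᵥ x ≤ r * (x ⬝ᵥ x)) :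
    hM.eigenvalues₀ ⟨k, hk⟩ ≤ r := by
  set q : Fin (Fintype.card ι) ≃ ι := Fintype.equivOfCardEq (Fintype.card_fin _) with hq
  let g : Fin (k + 1) → ι := fun a => q ⟨a, lt_of_lt_of_le a.2 hk⟩
  have hg : Function.Injective g := fun a b hab => by
    have := q.injective hab
    simpa [Fin.ext_iff] using this
  let S : (Fin (k + 1) → ℝ) →ₗ[ℝ] (ι → ℝ) :=
    ∑ a, (LinearMap.proj a : (Fin (k + 1) → ℝ) →ₗ[ℝ] ℝ).smulRight (eigenvec hM (g a))
  have hS : ∀ y, S y = ∑ a, y a • eigenvec hM (g a) := fun y => by simp [S]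
  -- Courant–Fischer: the span of the eigenvectors of the k + 1 largest eigenvalues is too large to
  -- avoid the kernel of k functionals.
  obtain ⟨y, hyker, hy0⟩ : ∃ y, (T ∘ₗ S) y = 0 ∧ y ≠ 0 := by
    have hlt : Module.finrank ℝ (Fin k → ℝ) < Module.finrank ℝ (Fin (k + 1) → ℝ) := by simp
    obtain ⟨y, hy, hy0⟩ := Submodule.exists_mem_ne_zero_of_ne_bot
      (LinearMap.ker_ne_bot_of_finrank_lt (f := T ∘ₗ S) hlt)
    exact ⟨y, hy, hy0⟩
  have hcoef : ∀ i, eigenvec hM i ⬝ᵥ S y = ∑ a, y a * if i = g a then 1 else 0 := by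
    intro i
    rw [hS, dotProduct_sum]
    refine Finset.sum_congr rfl fun a _ => ?_
    rw [dotProduct_smul, eigenvec_dotProduct, smul_eq_mul]
  have hcoefg : ∀ a, eigenvec hM (g a) ⬝ᵥ S y = y a := by
    intro a
    rw [hcoef]
    simp [hg.eq_iff]
  have hcoef0 : ∀ i, (∀ a, g a ≠ i) → eigenvec hM i ⬝ᵥ S y = 0 := by
    intro i hi
    rw [hcoef]
    exact Finset.sum_eq_zero fun a _ => by rw [if_neg (hi a).symm, mul_zero]
  have hpos : 0 < S y ⬝ᵥ S y := by
    rw [dotProduct_eq_sum_sq hM]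
    obtain ⟨a, ha⟩ := Function.ne_iff.1 hy0
    refine Finset.sum_pos' (fun i _ => sq_nonneg _) ⟨g a, Finset.mem_univ _, ?_⟩
    rw [hcoefg]
    have ha' : y a ≠ 0 := ha
    positivity
  have hle : hM.eigenvalues₀ ⟨k, hk⟩ * (S y ⬝ᵥ S y) ≤ S y ⬝ᵥ M *ᵥ S y := by
    rw [dotProduct_mulVec_eq_sum hM, dotProduct_eq_sum_sq hM, Finset.mul_sum]
    refine Finset.sum_le_sum fun i _ => ?_
    by_cases hi : ∃ a, g a = i
    · obtain ⟨a, rfl⟩ := hi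
      refine mul_le_mul_of_nonneg_right ?_ (sq_nonneg _)
      rw [Matrix.IsHermitian.eigenvalues]
      apply hM.eigenvalues₀_antitone
      simp only [g, ← hq, Equiv.symm_apply_apply]
      exact Fin.mk_le_mk.2 (Nat.lt_succ_iff.1 a.2)
    · push Not at hi
      rw [hcoef0 i hi]
      simp
  exact le_of_mul_le_mul_right (hle.trans (h _ hyker)) hpos

end Spectral

end XRam

/-! ### Lifts with small new eigenvalues -/

namespace XRam

set_option linter.unusedSectionVars false

section Lifts

open Matrix

variable {n c : ℕ} (A : Fin c → SimpleGraph (Fin n)) (v₁ : Fin n)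

/-- The additive product as a multigraph. -/
abbrev productGraph : Graph {s : List (Fin c × Fin n) // IsString A v₁ s}
    (Sym2 {s : List (Fin c × Fin n) // IsString A v₁ s}) :=
  Graph.ofSimpleGraph (additiveProduct A v₁)

noncomputable instance (N : ℕ) : Fintype (StringBall A v₁ N) := Fintype.ofFinite _

theorem ballMatrix_isHermitian (N : ℕ) : (ballMatrix A v₁ N).IsHermitian := by
  ext s t
  simp only [ballMatrix, Matrix.conjTranspose_apply, Matrix.of_apply, star_trivial]
  congr 1
  exact propext ⟨fun h => h.symm, fun h => h.symm⟩

theorem ballMatrix_nonneg (N : ℕ) (s t : StringBall A v₁ N) : 0 ≤ ballMatrix A v₁ N s t := by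
  simp only [ballMatrix, Matrix.of_apply]; split_ifs <;> norm_num

theorem pow_ballMatrix_apply (N t : ℕ) (s s' : StringBall A v₁ N) :
    0 ≤ (ballMatrix A v₁ N ^ t) s s' ∧
      (ballMatrix A v₁ N ^ t) s s' ≤ walkCount (productGraph A v₁) t s.1 s'.1 := by
  classical
  induction t generalizing s with
  | zero =>
    rw [pow_zero, Matrix.one_apply]
    split_ifs with h
    · subst h
      rw [walkCount_zero_self (Set.mem_univ _)]
      norm_num
    · exact ⟨le_rfl, Nat.cast_nonneg _⟩
  | succ t ih =>
    rw [pow_succ', Matrix.mul_apply]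
    refine ⟨Finset.sum_nonneg fun r _ => mul_nonneg (ballMatrix_nonneg A v₁ N s r) (ih r).1, ?_⟩
    have hX := linksInject_additiveProduct (A := A) v₁
    obtain ⟨g, hg, -⟩ := hX s.1 _ rfl
    have : Finite (Links (productGraph A v₁) s.1) := Finite.of_injective g hg
    have : Fintype (Links (productGraph A v₁) s.1) := Fintype.ofFinite _
    have : ∀ p : Links (productGraph A v₁) s.1, Finite (Walk (productGraph A v₁) t p.1.2 s'.1) :=
      fun p => (hX.walkCount_le t p.1.2 _ s'.1 rfl).1
    rw [walkCount, Nat.card_congr (walkSuccEquiv _ t _ _), Nat.card_sigma, Nat.cast_sum]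
    rw [← Finset.sum_filter_of_ne (p := fun r => (additiveProduct A v₁).Adj s.1 r.1)]
    · let e : {r : StringBall A v₁ N // (additiveProduct A v₁).Adj s.1 r.1} →
          Links (productGraph A v₁) s.1 := fun r => ⟨(s(s.1, r.1.1), r.1.1), rfl, r.2⟩
      have he : Function.Injective e := fun r r' h => by
        have h1 := congrArg (fun p : Links (productGraph A v₁) s.1 => p.1.2) h
        exact Subtype.ext (Subtype.ext h1)
      rw [Finset.sum_subtype (p := fun r => (additiveProduct A v₁).Adj s.1 r.1) _ (by simp)]
      calc _ ≤ ∑ r : {r : StringBall A v₁ N // (additiveProduct A v₁).Adj s.1 r.1},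
            (walkCount (productGraph A v₁) t (e r).1.2 s'.1 : ℝ) := by
            refine Finset.sum_le_sum fun r _ => ?_
            simp only [ballMatrix, Matrix.of_apply, if_pos r.2, one_mul]
            exact (ih r.1).2
        _ = ∑ p ∈ Finset.univ.image e, (walkCount (productGraph A v₁) t p.1.2 s'.1 : ℝ) :=
            by rw [Finset.sum_image he.injOn]
        _ ≤ _ := Finset.sum_le_sum_of_subset_of_nonneg (Finset.subset_univ _)
            fun p _ _ => Nat.cast_nonneg _
    · intro r _ hr
      by_contra h0
      simp [ballMatrix, h0] at hr

theorem specRadius_productGraph_nonneg : 0 ≤ specRadius (productGraph A v₁) :=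
  (linksInject_additiveProduct (A := A) v₁).specRadius_nonneg fun _ _ => ⟨_, rfl⟩

/-- Powers of the ball matrix count walks inside the ball, which are walks of X; for every r > ρ(X)
their number is eventually at most `r ^ t`. -/
theorem quadFormLE_ballMatrix (N : ℕ) :
    QuadFormLE (ballMatrix A v₁ N) (specRadius (productGraph A v₁)) := by
  refine quadFormLE_of_eigenvalues_le (ballMatrix_isHermitian A v₁ N) fun i => ?_
  refine le_of_forall_gt_imp_ge_of_dense fun r hr => ?_
  refine eigenvalues_le_of_eventually _ ((specRadius_productGraph_nonneg A v₁).trans_lt hr)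
    (fun k l => ?_) i
  filter_upwards [(linksInject_additiveProduct (A := A) v₁).eventually_walkCount_le
    (fun _ _ => ⟨_, rfl⟩) hr (Set.mem_univ k.1) (Set.mem_univ l.1)] with t ht
  exact ⟨(pow_ballMatrix_apply A v₁ N t k l).1, (pow_ballMatrix_apply A v₁ N t k l).2.trans ht⟩

variable {L : Type*} [Fintype L] [DecidableEq L]

/-- Some signing of a connected lift has its quadratic form bounded by the spectral radius of the
additive product. -/
theorem exists_signFlip_quadFormLE (σ : Fin c → Fin n → Equiv.Perm L) (l₀ : L)
    (hsurj : ∀ a, ∃ s, IsString A v₁ s ∧ liftMap v₁ σ l₀ s = a) :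
    ∃ S : Finset (Fin c × (Fin n × L)),
      QuadFormLE (∑ j, signFlip S (liftMatrix A σ) j) (specRadius (productGraph A v₁)) := by
  have hpos : ∀ x > specRadius (productGraph A v₁), ∀ W : Finset (Fin n × L),
      0 < signedMinorSum (liftMatrix A σ) x W := by
    intro x hx W
    induction W using Finset.strongInduction with
    | H W ih =>
      rcases W.eq_empty_or_nonempty with rfl | ⟨a, ha⟩
      · unfold signedMinorSum
        exact Finset.sum_pos (fun S _ => by rw [principalMinor_empty]; exact one_pos)
          Finset.univ_nonempty
      · obtain ⟨s, hs, rfl⟩ := hsurj a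
        -- This radius leaves room for |W| steps from s, one for each vertex removed in the
        -- comparison.
        have h := liftsTo_ballMatrix A v₁ σ l₀ (s.length + W.card)
        exact h.signedMinorSum_pos (fun Z => (quadFormLE_ballMatrix A v₁ _).principalMinor_pos
          (ballMatrix_isHermitian A v₁ _) hx Z) W ih ⟨⟨s, hs⟩, by simp⟩ ha le_rfl
  obtain ⟨S, hS⟩ := exists_signFlip_charpoly_pos (X := liftMatrix A σ)
    (liftMatrix_isSymm A σ) (ρ := specRadius (productGraph A v₁)) fun x hx => by
      have := hpos x hx Finset.univ
      simpa only [signedMinorSum, principalMinor_univ, signedResolvent, Matrix.eval_charpoly]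
        using this
  refine ⟨S, ?_⟩
  have hH : (∑ j, signFlip S (liftMatrix A σ) j).IsHermitian := by
    rw [Matrix.IsHermitian, Matrix.conjTranspose_sum]
    exact Finset.sum_congr rfl fun j _ => by
      rw [Matrix.conjTranspose_eq_transpose_of_trivial,
        (signFlip_isSymm (liftMatrix_isSymm A σ) S j).eq]
  refine quadFormLE_of_eigenvalues_le hH fun i => ?_
  by_contra hcon
  exact (hS _ (not_le.1 hcon)).ne' (eval_charpoly_eigenvalues hH i)

/-- On functions with zero sum over every fibre, the quadratic form of the lift is at most `r`
times the square of the norm. -/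
def NewQuadFormLE (σ : Fin c → Fin n → Equiv.Perm L) (r : ℝ) : Prop :=
  ∀ x : Fin n × L → ℝ, (∀ v, ∑ l, x (v, l) = 0) →
    x ⬝ᵥ (∑ j, liftMatrix A σ j) *ᵥ x ≤ r * (x ⬝ᵥ x)

variable {A} in
-- The set T reached by strings is closed under adjacency, so its fibres over the connected sum
-- graph all have the same size N. If T is proper, multiplying w by a function constant on T and on
-- its complement with zero fibre sums gives an eigenvector of the lift for μ > r, contradicting the
-- bound on new functions.
theorem exists_string_of_newQuadFormLE (hsum : (⨆ j, A j).Connected)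
    {σ : Fin c → Fin n → Equiv.Perm L} {r μ : ℝ} (h : NewQuadFormLE A σ r) (hμ : r < μ)
    {w : Fin n → ℝ} (hw0 : w ≠ 0) (hw : sumMatrix A *ᵥ w = μ • w) (l₀ : L) (a : Fin n × L) :
    ∃ s, IsString A v₁ s ∧ liftMap v₁ σ l₀ s = a := by
  classical
  set T : Set (Fin n × L) := {a | ∃ s, IsString A v₁ s ∧ liftMap v₁ σ l₀ s = a} with hT
  have hclosed : ∀ {j a b}, LiftAdj A σ j a b → a ∈ T → b ∈ T := by
    rintro j _ b hab ⟨s, hs, rfl⟩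
    obtain ⟨t, ht, -, h2, -⟩ := exists_liftMap_eq hs hab
    exact ⟨t, ht, h2⟩
  have hiff : ∀ {j a b}, LiftAdj A σ j a b → (a ∈ T ↔ b ∈ T) := fun hab =>
    ⟨hclosed hab, hclosed hab.symm⟩
  by_contra ha
  change a ∉ T at ha
  set fib : Fin n → Finset L := fun v => Finset.univ.filter fun l => (v, l) ∈ T with hfib
  have hle : ∀ u v, (⨆ j, A j).Adj u v → (fib u).card ≤ (fib v).card := by
    intro u v huv
    rw [SimpleGraph.iSup_adj] at huv
    obtain ⟨j, hj⟩ := huv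
    refine Finset.card_le_card_of_injOn (fun l => (σ j v).symm (σ j u l)) ?_
      ((σ j u).trans (σ j v).symm).injective.injOn
    intro l hl
    simp only [hfib, Finset.coe_filter, Finset.mem_univ, true_and, Set.mem_ofPred_eq] at hl ⊢
    exact hclosed (j := j) (a := (u, l)) ⟨hj, by simp [liftLabel]⟩ hl
  have hconst : ∀ v, (fib v).card = (fib v₁).card := by
    have hwalk : ∀ {u v} (_ : (⨆ j, A j).Walk u v), (fib u).card = (fib v).card := by
      intro u v p
      clear_value fib
      induction p with
      | nil => rfl
      | cons hadj _ ih => exact (le_antisymm (hle _ _ hadj) (hle _ _ hadj.symm)).trans ih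
    exact fun v => (hsum.preconnected v v₁).elim hwalk
  set N : ℕ := (fib v₁).card with hN
  have hNpos : 0 < N := Finset.card_pos.2 ⟨l₀, by
    simp only [hfib, Finset.mem_filter, Finset.mem_univ, true_and]
    exact ⟨[], trivial, rfl⟩⟩
  have hNlt : N < Fintype.card L := by
    rw [← hconst a.1]
    refine Finset.card_lt_univ_of_notMem (x := a.2) ?_
    simpa [hfib] using ha
  -- Each fibre has N points in T and |L| - N outside, so these two values sum to zero; neither
  -- vanishes because 0 < N < |L|.
  set φ : Fin n × L → ℝ := fun b => if b ∈ T then (Fintype.card L : ℝ) - N else -N with hφ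
  have hφ0 : ∀ b, φ b ≠ 0 := by
    intro b
    have h1 : (N : ℝ) < Fintype.card L := by exact_mod_cast hNlt
    have h2 : (0 : ℝ) < N := by exact_mod_cast hNpos
    simp only [hφ]
    split_ifs
    · linarith
    · linarith
  have hφadj : ∀ {j a b}, LiftAdj A σ j a b → φ a = φ b := fun hab => by
    simp only [hφ, hiff hab]
  set x : Fin n × L → ℝ := fun b => w b.1 * φ b with hx
  have hxsum : ∀ v, ∑ l, x (v, l) = 0 := by
    intro v
    simp only [hx, ← Finset.mul_sum, hφ, Finset.sum_ite, Finset.sum_const, nsmul_eq_mul]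
    have h1 := Finset.card_filter_add_card_filter_not (s := (Finset.univ : Finset L))
      fun l => (v, l) ∈ T
    have h2 := hconst v
    simp only [hfib] at h2
    rw [h2, Finset.card_univ] at h1
    rw [h2]
    have h3 : (N : ℝ) + (Finset.univ.filter fun l => (v, l) ∉ T).card = Fintype.card L := by
      exact_mod_cast h1
    rw [← h3]
    ring
  have hMx : (∑ j, liftMatrix A σ j) *ᵥ x = μ • x := by
    ext ⟨u, l⟩
    have h1 : ∀ j, (liftMatrix A σ j *ᵥ x) (u, l) =
        ∑ v, (if (A j).Adj u v then 1 else 0) * w v * φ (u, l) := by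
      intro j
      simp only [Matrix.mulVec, dotProduct]
      rw [Fintype.sum_prod_type]
      refine Finset.sum_congr rfl fun v _ => ?_
      by_cases hj : (A j).Adj u v
      · rw [Finset.sum_eq_single ((σ j v).symm (σ j u l))]
        · have hadj : LiftAdj A σ j (u, l) (v, (σ j v).symm (σ j u l)) :=
            ⟨hj, by simp [liftLabel]⟩
          simp only [liftMatrix, Matrix.of_apply, if_pos hadj, if_pos hj, hx, ← hφadj hadj]
          ring
        · intro l' _ hl'
          have : ¬ LiftAdj A σ j (u, l) (v, l') := fun h => hl' (by
            have := h.2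
            simp only [liftLabel] at this
            rw [this, Equiv.symm_apply_apply])
          simp [liftMatrix, this]
        · simp
      · rw [Finset.sum_eq_zero]
        · simp [hj]
        · intro l' _
          have : ¬ LiftAdj A σ j (u, l) (v, l') := fun h => hj h.1
          simp [liftMatrix, this]
    rw [Matrix.sum_mulVec, Finset.sum_apply]
    simp only [h1]
    rw [Finset.sum_comm]
    have h2 := congrFun hw u
    simp only [Matrix.mulVec, dotProduct, sumMatrix, Matrix.of_apply, Pi.smul_apply,
      smul_eq_mul] at h2
    simp only [← Finset.sum_mul, h2, Pi.smul_apply, smul_eq_mul, hx]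
    ring
  have hxx : 0 < x ⬝ᵥ x := by
    obtain ⟨v, hv⟩ := Function.ne_iff.1 hw0
    have hv' : w v ≠ 0 := hv
    have h1 : x (v, l₀) ≠ 0 := mul_ne_zero hv' (hφ0 _)
    exact Finset.sum_pos' (fun b _ => mul_self_nonneg _)
      ⟨(v, l₀), Finset.mem_univ _, mul_self_pos.2 h1⟩
  have := h x hxsum
  rw [hMx, dotProduct_smul, smul_eq_mul] at this
  nlinarith

/-- The double cover of a lift given by a signing. -/
def doubleLift (σ : Fin c → Fin n → Equiv.Perm L) (S : Finset (Fin c × (Fin n × L))) (j : Fin c)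
    (v : Fin n) : Equiv.Perm (L × Bool) where
  toFun p := (σ j v p.1, xor p.2 (decide ((j, (v, p.1)) ∈ S)))
  invFun p := ((σ j v).symm p.1, xor p.2 (decide ((j, (v, (σ j v).symm p.1)) ∈ S)))
  left_inv p := by simp
  right_inv p := by simp

/-- Put y and z for the sum and difference of x over the two sheets. Twice the form at x is the form
of the old lift at y plus the signed form at z. Zero fibre sums of x give zero fibre sums of y,
while z is unrestricted and is handled by the signing. -/
theorem NewQuadFormLE.doubleLift {σ : Fin c → Fin n → Equiv.Perm L} {r : ℝ}
    (h : NewQuadFormLE A σ r) {S : Finset (Fin c × (Fin n × L))}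
    (hS : QuadFormLE (∑ j, signFlip S (liftMatrix A σ) j) r) :
    NewQuadFormLE A (doubleLift σ S) r := by
  intro x hx
  set X : Fin n × L → Bool → ℝ := fun a b => x (a.1, (a.2, b)) with hX
  set y : Fin n × L → ℝ := fun a => X a false + X a true with hy
  set z : Fin n × L → ℝ := fun a => X a false - X a true with hz
  have hsum : ∀ F : Fin n × (L × Bool) → ℝ,
      ∑ p, F p = ∑ a : Fin n × L, (F (a.1, (a.2, false)) + F (a.1, (a.2, true))) := by
    intro F
    rw [← (Equiv.prodAssoc (Fin n) L Bool).sum_comp, Fintype.sum_prod_type]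
    refine Finset.sum_congr rfl fun a _ => ?_
    rw [Fintype.sum_bool, add_comm]
    rfl
  have hyz : ∀ (M : Matrix (Fin n × (L × Bool)) (Fin n × (L × Bool)) ℝ)
      (P Q : Matrix (Fin n × L) (Fin n × L) ℝ),
      (∀ a a', (∑ b, ∑ b', X a b * (M (a.1, (a.2, b)) (a'.1, (a'.2, b')) * X a' b')) * 2 =
        y a * (P a a' * y a') + z a * (Q a a' * z a')) →
      (x ⬝ᵥ M *ᵥ x) * 2 = y ⬝ᵥ P *ᵥ y + z ⬝ᵥ Q *ᵥ z := by
    intro M P Q hM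
    simp only [dotProduct, mulVec, hsum, Finset.mul_sum, Finset.sum_mul]
    rw [← Finset.sum_add_distrib]
    refine Finset.sum_congr rfl fun a _ => ?_
    rw [← Finset.sum_add_distrib, ← Finset.sum_add_distrib, Finset.sum_mul]
    refine Finset.sum_congr rfl fun a' _ => ?_
    rw [← hM a a']
    simp only [Fintype.sum_bool, hX]
    ring
  have hone : x ⬝ᵥ x * 2 = y ⬝ᵥ y + z ⬝ᵥ z := by
    simp only [dotProduct, hsum, Finset.sum_mul, ← Finset.sum_add_distrib]
    refine Finset.sum_congr rfl fun a _ => ?_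
    simp only [hy, hz, hX]
    ring
  have hentry : ∀ j, (x ⬝ᵥ liftMatrix A (XRam.doubleLift σ S) j *ᵥ x) * 2 =
      y ⬝ᵥ liftMatrix A σ j *ᵥ y + z ⬝ᵥ signFlip S (liftMatrix A σ) j *ᵥ z := by
    refine fun j => hyz _ _ _ fun a a' => ?_
    have hadj : ∀ b b', LiftAdj A (XRam.doubleLift σ S) j (a.1, (a.2, b)) (a'.1, (a'.2, b')) ↔
        LiftAdj A σ j a a' ∧ xor b (decide ((j, a) ∈ S)) = xor b' (decide ((j, a') ∈ S)) := by
      intro b b'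
      simp [LiftAdj, liftLabel, XRam.doubleLift, and_assoc]
    have hval : ∀ b b', liftMatrix A (XRam.doubleLift σ S) j (a.1, (a.2, b)) (a'.1, (a'.2, b')) =
        liftMatrix A σ j a a' *
          if xor b (decide ((j, a) ∈ S)) = xor b' (decide ((j, a') ∈ S)) then 1 else 0 := by
      intro b b'
      simp only [liftMatrix, Matrix.of_apply]
      by_cases h0 : LiftAdj A σ j a a'
      · by_cases h1 : xor b (decide ((j, a) ∈ S)) = xor b' (decide ((j, a') ∈ S))
        · rw [if_pos ((hadj b b').2 ⟨h0, h1⟩), if_pos h0, if_pos h1, mul_one]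
        · rw [if_neg fun h => h1 ((hadj b b').1 h).2, if_neg h1, mul_zero]
      · rw [if_neg fun h => h0 ((hadj b b').1 h).1, if_neg h0, zero_mul]
    simp only [hval, signFlip, Matrix.of_apply, Fintype.sum_bool, hy, hz, sgn]
    by_cases h1 : (j, a) ∈ S <;> by_cases h2 : (j, a') ∈ S <;> simp [h1, h2] <;> ring
  have hmain : (x ⬝ᵥ (∑ j, liftMatrix A (XRam.doubleLift σ S) j) *ᵥ x) * 2 =
      y ⬝ᵥ (∑ j, liftMatrix A σ j) *ᵥ y + z ⬝ᵥ (∑ j, signFlip S (liftMatrix A σ) j) *ᵥ z := by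
    simp only [Matrix.sum_mulVec, dotProduct_sum, Finset.sum_mul, hentry, Finset.sum_add_distrib]
  have hy0 : ∀ v, ∑ l, y (v, l) = 0 := by
    intro v
    rw [← hx v, Fintype.sum_prod_type]
    refine Finset.sum_congr rfl fun l _ => ?_
    rw [Fintype.sum_bool, add_comm]
  have hr : r * (x ⬝ᵥ x) * 2 = r * (y ⬝ᵥ y) + r * (z ⬝ᵥ z) := by rw [mul_assoc, hone, mul_add]
  linarith [h y hy0, hS z]

theorem newQuadFormLE_unit (r : ℝ) :
    NewQuadFormLE A (fun _ _ => Equiv.refl Unit) r := by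
  intro x hx
  have : x = 0 := by
    ext ⟨v, l⟩
    simpa using hx v
  simp [this]

variable {A} in
/-- Iterating signed double covers gives arbitrarily large lifts whose new eigenvalues are at most
the spectral radius of the additive product. -/
theorem exists_newQuadFormLE (hsum : (⨆ j, A j).Connected) {μ : ℝ}
    (hμ : specRadius (productGraph A v₁) < μ) {w : Fin n → ℝ} (hw0 : w ≠ 0)
    (hw : sumMatrix A *ᵥ w = μ • w) (m : ℕ) :
    ∃ (L : Type) (_ : Fintype L) (_ : DecidableEq L) (σ : Fin c → Fin n → Equiv.Perm L),
      Fintype.card L = 2 ^ m ∧ NewQuadFormLE A σ (specRadius (productGraph A v₁)) := by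
  induction m with
  | zero => exact ⟨Unit, inferInstance, inferInstance, _, by simp, newQuadFormLE_unit A _⟩
  | succ m ih =>
    obtain ⟨L, _, _, σ, hL, hσ⟩ := ih
    have hne : Nonempty L := Fintype.card_pos_iff.1 (by rw [hL]; positivity)
    obtain ⟨S, hS⟩ := exists_signFlip_quadFormLE A v₁ σ hne.some
      (exists_string_of_newQuadFormLE v₁ hsum hσ hμ hw0 hw hne.some)
    exact ⟨L × Bool, inferInstance, inferInstance, _, by simp [hL, pow_succ], hσ.doubleLift A hS⟩

variable {A} in
-- Otherwise all eigenvalues of the sum graph are at most ρ(X), also in absolute value by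
-- nonnegativity, and its walks number at most a constant times ρ(X)^t. Walks in any quotient of X
-- inject into these, so χ(X) ≤ ρ(X).
theorem exists_eigenvector_of_lt_chi
    (hχ : specRadius (productGraph A v₁) < chi (productGraph A v₁)) :
    ∃ μ, specRadius (productGraph A v₁) < μ ∧ ∃ w : Fin n → ℝ, w ≠ 0 ∧
      sumMatrix A *ᵥ w = μ • w := by
  have hρ := specRadius_productGraph_nonneg A v₁
  have hH : (sumMatrix A).IsHermitian := by
    ext a b
    simp only [sumMatrix, Matrix.conjTranspose_apply, Matrix.of_apply, star_trivial]
    exact Finset.sum_congr rfl fun j _ => by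
      congr 1
      exact propext ((A j).adj_comm b a)
  by_contra hcon
  have hle : ∀ i, hH.eigenvalues i ≤ specRadius (productGraph A v₁) := by
    intro i
    by_contra h
    refine hcon ⟨_, not_le.1 h, eigenvec hH i, fun h0 => ?_, mulVec_eigenvec hH i⟩
    have := eigenvec_dotProduct hH i i
    rw [h0] at this
    simp at this
  obtain ⟨C, hC⟩ := exists_pow_mulVec_le hH
    (abs_eigenvalues_le hH (sumMatrix_nonneg A) (quadFormLE_of_eigenvalues_le hH hle)) 1
  rw [chi] at hχ
  -- Nonnegativity of ρ(X) is needed because the supremum of an empty set is 0.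
  refine not_le.2 hχ (Real.sSup_le ?_ hρ)
  rintro _ ⟨G, ⟨fV, fE, hcov⟩, rfl⟩
  refine ((linksInject_additiveProduct (A := A) v₁).of_isCovering hcov).specRadius_le ?_
    ⟨_, (fV ⟨⟨[], trivial⟩, Set.mem_univ _⟩).2⟩ hρ hC
  intro x hx
  obtain ⟨s, hs⟩ := hcov.surjective_vertex ⟨x, hx⟩
  exact ⟨_, s, by rw [hs], rfl⟩

end Lifts

end XRam

/-! ### The lift as a finite quotient -/

namespace XRam

set_option linter.unusedSectionVars false

section LiftGraph

open Matrix

variable {n c : ℕ} (A : Fin c → SimpleGraph (Fin n)) {L : Type}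

/-- The lift given by the permutations `σ`, as a multigraph. -/
def liftGraph (σ : Fin c → Fin n → Equiv.Perm L) :
    Graph (Fin n × L) (Fin c × Sym2 (Fin n × L)) where
  vertexSet := Set.univ
  IsLink e x y := e.2 = s(x, y) ∧ LiftAdj A σ e.1 x y
  isLink_symm _ _ := ⟨fun _ _ h => ⟨h.1.trans Sym2.eq_swap, h.2.symm⟩⟩
  eq_or_eq_of_isLink_of_isLink e x y v w h h' := by
    have := h.1.symm.trans h'.1
    rw [Sym2.eq_iff] at this
    rcases this with h | h
    exacts [Or.inl h.1, Or.inr h.1]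
  left_mem_of_isLink _ _ _ _ := Set.mem_univ _

variable (v₁ : Fin n)

/-- An edge determines its unordered pair of ends, so one colour serves both orientations. -/
theorem exists_colour (e : E(productGraph A v₁)) : ∃ j, ∀ s t, (productGraph A v₁).IsLink e s t →
    stringKey j s.1 = stringKey j t.1 ∧ (A j).Adj (endpoint v₁ s.1) (endpoint v₁ t.1) := by
  obtain ⟨s, t, h⟩ := Graph.exists_isLink_of_mem_edgeSet e.2
  have hadj : (additiveProduct A v₁).Adj s t := by
    have h2 := h.2
    rw [h.1] at h2
    exact h2
  obtain ⟨j, hk, hj⟩ := (additiveProduct_adj_iff s t).1 hadj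
  refine ⟨j, fun s' t' h' => ?_⟩
  rcases h.eq_and_eq_or_eq_and_eq h' with ⟨rfl, rfl⟩ | ⟨rfl, rfl⟩
  exacts [⟨hk, hj⟩, ⟨hk.symm, hj.symm⟩]

/-- Local bijectivity holds because a neighbour in a given copy is determined by its endpoint, and
every edge of the lift lifts to X. Surjectivity on vertices is the assumed connectedness of the
lift. -/
theorem covers_liftGraph {σ : Fin c → Fin n → Equiv.Perm L} {l₀ : L}
    (hsurj : ∀ a, ∃ s, IsString A v₁ s ∧ liftMap v₁ σ l₀ s = a) :
    Covers (productGraph A v₁) (liftGraph A σ) := by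
  choose col hcol using exists_colour A v₁
  let f : {s : List (Fin c × Fin n) // IsString A v₁ s} → Fin n × L := fun s => liftMap v₁ σ l₀ s.1
  have hlink : ∀ (e : E(productGraph A v₁)) (s t), (productGraph A v₁).IsLink e s t →
      (liftGraph A σ).IsLink (col e, Sym2.map f e.1) (f s) (f t) := fun e s t h =>
    ⟨by simp only [h.1, Sym2.map_mk], liftAdj_liftMap (hcol e s t h).1 (hcol e s t h).2⟩
  have hmem : ∀ e : E(productGraph A v₁), (col e, Sym2.map f e.1) ∈ E(liftGraph A σ) := fun e => by
    obtain ⟨s, t, h⟩ := Graph.exists_isLink_of_mem_edgeSet e.2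
    exact (hlink e s t h).edge_mem
  let fV : V(productGraph A v₁) → V(liftGraph A σ) := fun s => ⟨f s.1, Set.mem_univ _⟩
  let fE : E(productGraph A v₁) → E(liftGraph A σ) := fun e => ⟨_, hmem e⟩
  have hfV : Function.Surjective fV := by
    rintro ⟨a, ha⟩
    obtain ⟨s, hs, rfl⟩ := hsurj a
    exact ⟨⟨⟨s, hs⟩, Set.mem_univ _⟩, rfl⟩
  have hbij : ∀ x : V(productGraph A v₁), Set.BijOn fE {e | (productGraph A v₁).Inc e x}
      {e | (liftGraph A σ).Inc e (fV x)} := by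
    intro x
    refine ⟨?_, ?_, ?_⟩
    · rintro e ⟨t, h⟩
      exact ⟨f t, hlink e _ _ h⟩
    · rintro e ⟨t, h⟩ e' ⟨t', h'⟩ hee
      have hee' := congrArg Subtype.val hee
      simp only [fE, Prod.mk.injEq, h.1, h'.1, Sym2.map_mk] at hee'
      have h1 : f t = f t' := Sym2.congr_right.1 hee'.2
      have h2 := (hcol e _ _ h).1
      rw [hee'.1, (hcol e' _ _ h').1] at h2
      have h3 := congrArg Prod.fst h1
      simp only [f, liftMap_fst] at h3
      have h4 : t = t' := Subtype.ext (stringKey_endpoint_injective t.2 t'.2 h2.symm h3)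
      exact Subtype.ext (by rw [h.1, h'.1, h4])
    · rintro ⟨⟨j, q⟩, he⟩ ⟨b, hq, hb⟩
      obtain ⟨t, ht, hk, rfl, -⟩ := exists_liftMap_eq x.1.2 hb
      have hA : (A j).Adj (endpoint v₁ x.1.1) (endpoint v₁ t) := by
        have h1 := hb.1
        rwa [liftMap_fst, liftMap_fst] at h1
      have hadj : (additiveProduct A v₁).Adj x.1 ⟨t, ht⟩ :=
        (additiveProduct_adj_iff _ _).2 ⟨j, hk, hA⟩
      have hl : (productGraph A v₁).IsLink s(x.1, ⟨t, ht⟩) x.1 ⟨t, ht⟩ := ⟨rfl, hadj⟩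
      refine ⟨⟨_, hl.edge_mem⟩, ⟨_, hl⟩, Subtype.ext (Prod.ext ?_ ?_)⟩
      -- The colour chosen for this edge must be j, since its distinct ends share a copy for only
      -- one colour.
      · exact eq_of_stringKey_eq (fun h => hadj.ne (Subtype.ext h))
          (hcol ⟨_, hl.edge_mem⟩ _ _ hl).1 hk
      · simp only [fE, Sym2.map_mk]
        exact hq.symm
  refine ⟨fV, fE, hfV, ?_, fun e x y h => hlink e _ _ h, hbij⟩
  intro e
  obtain ⟨a, b, h⟩ := Graph.exists_isLink_of_mem_edgeSet e.2
  obtain ⟨x, hx⟩ := hfV ⟨a, h.left_mem⟩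
  obtain ⟨e', -, he'⟩ := (hbij x).surjOn (show e ∈ {e : E(liftGraph A σ) |
    (liftGraph A σ).Inc e (fV x)} from ⟨b, by rw [hx]; exact h⟩)
  exact ⟨e', he'⟩

variable [Fintype L] [DecidableEq L]

/-- The lift given by the permutations `σ`, as a finite multigraph. -/
def liftFinGraph (σ : Fin c → Fin n → Equiv.Perm L) : FinGraph where
  α := Fin n × L
  β := Fin c × Sym2 (Fin n × L)
  graph := liftGraph A σ
  finite_vertexSet := Set.toFinite _
  finite_edgeSet := Set.toFinite _

theorem adjMatrix_liftFinGraph (σ : Fin c → Fin n → Equiv.Perm L) (x y : Fin n × L) :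
    (liftFinGraph A σ).adjMatrix ⟨x, Set.mem_univ x⟩ ⟨y, Set.mem_univ y⟩ =
      (∑ j, liftMatrix A σ j) x y := by
  classical
  have h : Nat.card {e : E(liftGraph A σ) // (liftGraph A σ).IsLink e x y} =
      Nat.card {j // LiftAdj A σ j x y} := by
    refine Nat.card_congr ⟨fun e => ⟨e.1.1.1, e.2.2⟩,
      fun j => ⟨⟨(j.1, s(x, y)), ⟨x, y, rfl, j.2⟩⟩, ⟨rfl, j.2⟩⟩, fun e => ?_, fun j => rfl⟩
    exact Subtype.ext (Subtype.ext (Prod.ext rfl e.2.1.symm))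
  rw [Matrix.sum_apply]
  simp only [liftMatrix, Matrix.of_apply, FinGraph.adjMatrix]
  refine (congrArg Nat.cast h).trans ?_
  rw [Finset.sum_boole, Nat.card_eq_fintype_card, Fintype.card_subtype]

theorem card_vertexSet_liftFinGraph (σ : Fin c → Fin n → Equiv.Perm L) :
    Nat.card V((liftFinGraph A σ).graph) = n * Fintype.card L := by
  rw [Nat.card_congr (show V((liftFinGraph A σ).graph) ≃ Fin n × L from Equiv.Set.univ _)]
  simp

/-- The n fibre sums are the linear functionals whose common kernel carries the bound. -/
theorem eigenvalue_liftFinGraph_le {σ : Fin c → Fin n → Equiv.Perm L} {r : ℝ}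
    (h : NewQuadFormLE A σ r) (hn : n < Fintype.card V((liftFinGraph A σ).graph)) :
    (liftFinGraph A σ).eigenvalue ⟨n, hn⟩ ≤ r := by
  let q : V((liftFinGraph A σ).graph) ≃ Fin n × L := Equiv.Set.univ _
  let T : (V((liftFinGraph A σ).graph) → ℝ) →ₗ[ℝ] (Fin n → ℝ) :=
    { toFun := fun x v => ∑ l, x (q.symm (v, l))
      map_add' := fun x y => by ext v; simp [Finset.sum_add_distrib]
      map_smul' := fun a x => by ext v; simp [Finset.mul_sum] }
  refine eigenvalues₀_le_of_ker _ hn T fun x hx => ?_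
  have h1 := h (fun a => x (q.symm a)) fun v => congrFun hx v
  have h2 : x ⬝ᵥ x = (fun a => x (q.symm a)) ⬝ᵥ fun a => x (q.symm a) := by
    simp only [dotProduct]
    exact (q.symm.sum_comp fun a => x a * x a).symm
  have h3 : x ⬝ᵥ (liftFinGraph A σ).adjMatrix *ᵥ x =
      (fun a => x (q.symm a)) ⬝ᵥ (∑ j, liftMatrix A σ j) *ᵥ fun a => x (q.symm a) := by
    simp only [dotProduct, mulVec]
    rw [← q.symm.sum_comp]
    refine Finset.sum_congr rfl fun a _ => ?_
    rw [← q.symm.sum_comp]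
    congr 1
    refine Finset.sum_congr rfl fun b _ => ?_
    rw [← adjMatrix_liftFinGraph]
    rfl
  rw [h2, h3]
  exact h1

theorem isQuasiRamanujan_of_lt_chi (hsum : (⨆ j, A j).Connected)
    (hχ : specRadius (productGraph A v₁) < chi (productGraph A v₁)) :
    IsQuasiRamanujan n (productGraph A v₁) := by
  have hn : 0 < n := v₁.pos
  obtain ⟨μ, hμ, w, hw0, hw⟩ := exists_eigenvector_of_lt_chi v₁ hχ
  -- The exponent i + 1 ensures more than n vertices even for i = 0; distinct i give distinct
  -- orders, hence non-isomorphic graphs.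
  have key : ∀ i : ℕ, ∃ G : FinGraph, (G ∈ FinQuo (productGraph A v₁) ∧
      ∃ hk : n < Fintype.card V(G.graph), G.eigenvalue ⟨n, hk⟩ ≤ specRadius (productGraph A v₁)) ∧
      Nat.card V(G.graph) = n * 2 ^ (i + 1) := by
    intro i
    obtain ⟨L, _, _, σ, hL, hσ⟩ := exists_newQuadFormLE v₁ hsum hμ hw0 hw (i + 1)
    have hne : Nonempty L := Fintype.card_pos_iff.1 (by rw [hL]; positivity)
    have hcard := card_vertexSet_liftFinGraph A σ
    rw [hL] at hcard
    have hlt : n < Fintype.card V((liftFinGraph A σ).graph) := by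
      rw [← Nat.card_eq_fintype_card, hcard]
      exact lt_mul_of_one_lt_right hn (Nat.one_lt_two_pow (Nat.succ_ne_zero i))
    exact ⟨liftFinGraph A σ, ⟨covers_liftGraph A v₁
      (exists_string_of_newQuadFormLE v₁ hsum hσ hμ hw0 hw hne.some), hlt,
      eigenvalue_liftFinGraph_le A hσ hlt⟩, hcard⟩
  choose G hG hcard using key
  refine ⟨hn, G, hG, fun i j hij ⟨fV, _⟩ => hij ?_⟩
  have := Nat.card_congr fV
  rw [hcard, hcard] at this
  have h1 := Nat.pow_right_injective le_rfl (Nat.eq_of_mul_eq_mul_left hn this)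
  omega

end LiftGraph

end XRam

theorem mainTheorem1 {n c : ℕ} (A : Fin c → SimpleGraph (Fin n))
    (hsum : (⨆ j, A j).Connected)
    (hatom : ∀ j, (A j).support.Nonempty ∧ ((A j).induce (A j).support).Connected)
    (v₁ : Fin n)
    (hχ : XRam.specRadius (Graph.ofSimpleGraph (XRam.additiveProduct A v₁)) <
      XRam.chi (Graph.ofSimpleGraph (XRam.additiveProduct A v₁))) :
    (∃ k : ℕ, XRam.IsQuasiRamanujan k (Graph.ofSimpleGraph (XRam.additiveProduct A v₁))) ∧
      XRam.IsQuasiRamanujan n (Graph.ofSimpleGraph (XRam.additiveProduct A v₁)) :=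
  have h := XRam.isQuasiRamanujan_of_lt_chi A v₁ hsum hχ
  ⟨⟨n, h⟩, h⟩
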